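/- There is an absolute constant $C$ such that the following holds for all integers $d\ge 0$ and $t\ge 1$. Let $F\in\mathbb{R}[X,Y]$ be a nonzero polynomial of total degree $d$, and let $G\in\mathbb{R}[X,Y]$ be a polynomial with at most $t$ monomials ($G=0$ is allowed). Let $S=\{(x,y)\in\mathbb{R}^2 : F(x,y)=G(x,y)=0\}$, with the topology induced from $\mathbb{R}^2$. Then $S$ has finitely many connected components, and their number is at most $C\,(d^3t+d^2t^3)$. In particular, if $S$ is finite, then it has at most $C\,(d^3t+d^2t^3)$ points, where all real solutions, degenerate ones included, are counted (each one once). -/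

import Mathlib

/-- The set of real solutions `(x, y) = (p 0, p 1)` of the system `F(X, Y) = G(X, Y) = 0`,
where `X` and `Y` are the variables of index `0` and `1`. -/
def realSolutions (F G : MvPolynomial (Fin 2) ℝ) : Set (Fin 2 → ℝ) :=
  {p | MvPolynomial.eval p F = 0 ∧ MvPolynomial.eval p G = 0}

/-- A polynomial is `t`-sparse if it has at most `t` monomials. -/
def IsSparse (t : ℕ) (G : MvPolynomial (Fin 2) ℝ) : Prop :=
  G.support.card ≤ t

/-! Zero sets unite over the irreducible factors of $F$, and $d^3$, $d^2$ are superadditive in $d$,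
so it suffices to treat irreducible $F$. Throughout, $S$ is covered by boundedly many preconnected
pieces.

Special cases: a curve that is a vertical line or the line $Y=0$ leaves a sparse univariate
polynomial, and Descartes' rule applies. If $F\mid F_Y$ then $F_Y=0$, and apart from vertical lines
there are no real points. Otherwise, removing the points over $O(d^2)$ critical abscissas, $O(d^3)$
of them, leaves $O(d^3)$ graphs of differentiable functions (`nonempty_curveBranches`). If $F\mid
G$, these points and graphs are the pieces.

If $F\nmid G$, the zeros of $G$ on the branches are counted with Wronskians for the derivation
$D=XY(F_Y\partial_X-F_X\partial_Y)$, tangent to the curve. Modulo $F$, $G$ is a combination $g$ of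
$s\le t$ monomials $f_0,\dots,f_{s-1}$ independent modulo $F$. With $W_k=W(f_0,\dots,f_{k-1})$, the
quotient $W(f_0,\dots,f_{k-1},g)/W_{k+1}$ has derivative $W_k\,W(f_0,\dots,f_k,g)/W_{k+1}^2$
(`snocWronskian_identity`). Rolle on each branch therefore bounds the zeros of $g$ by those of the
$W_k$, plus the number of branches at each step; the last Wronskian is a constant times $W_s$.

The factor $XY$ in $D$ makes $W_k$ a monomial times a polynomial of degree at most $k^2d$, whatever
the exponents (`exists_wronskian_monomial_eq`). Off the axes only the latter vanishes, and Bezout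
gives at most $k^2d^2$ zeros, as $F\nmid W_k$ by independence (`not_dvd_derivationWronskian`). Over
at most $t$ steps the total is $O(t(d^2t^2+d^3))$. -/

open MvPolynomial

/-! ### Bezout's inequality for real points, by dimension counting. -/

/-- The dimension of the space of polynomials in two variables of degree at most `m`. -/
theorem finrank_restrictTotalDegree_two (m : ℕ) :
    2 * Module.finrank ℝ (restrictTotalDegree (Fin 2) ℝ m) = (m + 1) * (m + 2) := by
  have e : {n : Fin 2 →₀ ℕ | Finsupp.degree n ≤ m} ≃ (Finset.range (m + 1)).sigma
      (fun k => Finset.HasAntidiagonal.antidiagonal k) :=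
    { toFun := fun n => ⟨⟨n.1 0 + n.1 1, (n.1 0, n.1 1)⟩, by
        have := n.2
        simp [Finsupp.degree_eq_sum] at this ⊢
        omega⟩
      invFun := fun z => ⟨Finsupp.equivFunOnFinite.symm ![z.1.2.1, z.1.2.2], by
        have := Finset.mem_sigma.mp z.2
        simp only [Finset.mem_range, Finset.HasAntidiagonal.mem_antidiagonal] at this
        simp [Finsupp.degree_eq_sum]
        omega⟩
      left_inv := fun n => by
        ext i
        fin_cases i <;> simp
      right_inv := fun z => by
        rcases z with ⟨⟨k, a, b⟩, h⟩
        simp at h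
        obtain ⟨h1, rfl⟩ := h
        simp }
  have b := (basisRestrictSupport ℝ {n : Fin 2 →₀ ℕ | Finsupp.degree n ≤ m})
  have h1 : Module.finrank ℝ (restrictTotalDegree (Fin 2) ℝ m) =
      Nat.card {n : Fin 2 →₀ ℕ | Finsupp.degree n ≤ m} := by
    have := Module.finrank_eq_nat_card_basis b
    exact this
  rw [h1, Nat.card_congr e]
  simp only [Nat.card_eq_fintype_card, Fintype.card_coe, Finset.card_sigma,
    Finset.Nat.card_antidiagonal]
  clear e b h1
  induction m with
  | zero => simp
  | succ n ih => rw [Finset.sum_range_succ, mul_add, ih]; ring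

/-- There is a polynomial of degree at most `#s` that vanishes on `s` except at `p`. -/
theorem exists_lagrange_polynomial (s : Finset (Fin 2 → ℝ)) (p : Fin 2 → ℝ) :
    ∃ Q : MvPolynomial (Fin 2) ℝ, Q.totalDegree ≤ s.card ∧ eval p Q ≠ 0 ∧
      ∀ q ∈ s, q ≠ p → eval q Q = 0 := by
  classical
  have h : ∀ q : Fin 2 → ℝ, ∃ L : MvPolynomial (Fin 2) ℝ, L.totalDegree ≤ 1 ∧
      (q ≠ p → eval p L ≠ 0 ∧ eval q L = 0) := by
    intro q
    by_cases hq : q = p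
    · exact ⟨0, by simp, by simp [hq]⟩
    -- A coordinate line through `q` that misses `p`.
    · obtain ⟨i, hi⟩ := Function.ne_iff.mp hq
      refine ⟨X i - C (q i), ?_, fun _ => ⟨?_, by simp⟩⟩
      · exact (totalDegree_sub_C_le _ _).trans (totalDegree_X (R := ℝ) i).le
      · simpa [sub_eq_zero] using fun h => hi h.symm
  choose L hL1 hL2 using h
  refine ⟨∏ q ∈ s.erase p, L q, ?_, ?_, ?_⟩
  · refine (totalDegree_finsetProd _ _).trans ((Finset.sum_le_card_nsmul _ _ 1
      fun q _ => hL1 q).trans ?_)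
    simpa using Finset.card_le_card (Finset.erase_subset p s)
  · rw [eval_prod, Finset.prod_ne_zero_iff]
    intro q hq
    exact (hL2 q (Finset.ne_of_mem_erase hq)).1
  · intro q hq hqp
    rw [eval_prod]
    exact Finset.prod_eq_zero (Finset.mem_erase.mpr ⟨hqp, hq⟩) (hL2 q hqp).2

theorem finrank_map_mulLeft (F : MvPolynomial (Fin 2) ℝ) (hF : F ≠ 0) (m : ℕ) :
    Module.finrank ℝ ((restrictTotalDegree (Fin 2) ℝ m).map (LinearMap.mulLeft ℝ F)) =
      Module.finrank ℝ (restrictTotalDegree (Fin 2) ℝ m) :=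
  (Submodule.equivMapOfInjective _ (mul_right_injective₀ hF) _).finrank_eq.symm

/-- Bezout's inequality for real points of an irreducible plane curve. -/
theorem card_common_zeros_le {F H : MvPolynomial (Fin 2) ℝ} (hF : Irreducible F) (hFH : ¬ F ∣ H)
    (s : Finset (Fin 2 → ℝ)) (hs : ∀ p ∈ s, eval p F = 0 ∧ eval p H = 0) :
    s.card ≤ F.totalDegree * H.totalDegree := by
  classical
  set d := F.totalDegree with hd
  set e := H.totalDegree with he
  have hF0 : F ≠ 0 := hF.ne_zero
  have hH0 : H ≠ 0 := fun h => hFH (h ▸ dvd_zero F)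
  set n := s.card with hn
  set R := fun m => restrictTotalDegree (Fin 2) ℝ m with hR
  set A := (R (n + e)).map (LinearMap.mulLeft ℝ F) with hA
  set B := (R (n + d)).map (LinearMap.mulLeft ℝ H) with hB
  -- The space $A+B$ vanishes on `s`, and $A\cap B$ lies in the multiples of $FH$. Evaluation on `s`
  -- is onto in degree $n+d+e$, so $n\le\dim R_{n+d+e}-\dim R_{n+e}-\dim R_{n+d}+\dim R_n$. This
  -- mixed second difference of $(m+1)(m+2)/2$ is exactly $de$.
  have hAB : A ⊓ B ≤ (R n).map (LinearMap.mulLeft ℝ (F * H)) := by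
    rintro P ⟨⟨a, ha, rfl⟩, ⟨b, hb, hab⟩⟩
    simp only [LinearMap.mulLeft_apply] at hab
    have : F ∣ b := (hF.prime.dvd_or_dvd (hab ▸ dvd_mul_right F a : F ∣ H * b)).resolve_left hFH
    obtain ⟨c, rfl⟩ := this
    refine ⟨c, ?_, by simp only [LinearMap.mulLeft_apply]; rw [← hab]; ring⟩
    have hb' : (F * c).totalDegree ≤ n + d := (mem_restrictTotalDegree _ _ _).mp hb
    refine (mem_restrictTotalDegree _ _ _).mpr ?_
    by_cases hc : c = 0
    · simp [hc]
    · rw [totalDegree_mul_of_isDomain hF0 hc] at hb'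
      omega
  have hle : A ⊔ B ≤ R (n + d + e) := by
    refine sup_le ?_ ?_
    · rintro _ ⟨a, ha, rfl⟩
      have : a.totalDegree ≤ n + e := (mem_restrictTotalDegree _ _ _).mp ha
      exact (mem_restrictTotalDegree _ _ _).mpr ((totalDegree_mul _ _).trans (by omega))
    · rintro _ ⟨a, ha, rfl⟩
      have : a.totalDegree ≤ n + d := (mem_restrictTotalDegree _ _ _).mp ha
      exact (mem_restrictTotalDegree _ _ _).mpr ((totalDegree_mul _ _).trans (by omega))
  let ev : MvPolynomial (Fin 2) ℝ →ₗ[ℝ] (s → ℝ) :=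
    LinearMap.pi fun p => (aeval (R := ℝ) p.1).toLinearMap
  have hev : ∀ Q p, ev Q p = eval p.1 Q := fun Q p => by
    simp [ev, MvPolynomial.aeval_eq_eval]
  let ev' := ev.domRestrict (R (n + d + e))
  have hsurj : LinearMap.range ev' = ⊤ := by
    rw [eq_top_iff, ← (Pi.basisFun ℝ s).span_eq, Submodule.span_le]
    rintro _ ⟨p, rfl⟩
    obtain ⟨Q, hQ1, hQ2, hQ3⟩ := exists_lagrange_polynomial s p.1
    refine ⟨⟨(eval p.1 Q)⁻¹ • Q, ?_⟩, ?_⟩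
    · exact (mem_restrictTotalDegree _ _ _).mpr
        ((totalDegree_smul_le _ _).trans (hQ1.trans (by omega)))
    · ext q
      simp only [ev', LinearMap.domRestrict_apply, hev, smul_eval, Pi.basisFun_apply]
      by_cases hq : q = p
      · subst hq; simp [hQ2]
      · rw [hQ3 q.1 q.2 (fun h => hq (Subtype.ext h))]
        simp [hq]
  have hker : (A ⊔ B).comap (R (n + d + e)).subtype ≤ LinearMap.ker ev' := by
    intro P hP
    obtain ⟨_, ⟨a, ha, rfl⟩, _, ⟨b, hb, rfl⟩, hab⟩ := Submodule.mem_sup.mp hP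
    rw [LinearMap.mem_ker]
    ext q
    have h1 := hs q.1 q.2
    simp only [ev', LinearMap.domRestrict_apply, hev]
    change _ = P.1 at hab
    rw [← hab]
    simp [h1.1, h1.2]
  have e1 : Module.finrank ℝ ((A ⊔ B).comap (R (n + d + e)).subtype) =
      Module.finrank ℝ (A ⊔ B : Submodule ℝ _) :=
    (Submodule.comapSubtypeEquivOfLe hle).finrank_eq
  have e2 := Submodule.finrank_mono hker
  have e3 := LinearMap.finrank_range_add_finrank_ker ev'
  rw [hsurj, finrank_top, Module.finrank_pi, Fintype.card_coe] at e3
  have : Module.Finite ℝ A := inferInstanceAs (Module.Finite ℝ ((R (n + e)).map _))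
  have : Module.Finite ℝ B := inferInstanceAs (Module.Finite ℝ ((R (n + d)).map _))
  have e4 := Submodule.finrank_sup_add_finrank_inf_eq A B
  have e5 := Submodule.finrank_mono hAB
  rw [finrank_map_mulLeft _ (mul_ne_zero hF0 hH0)] at e5
  rw [hA, finrank_map_mulLeft _ hF0, ← hA, hB, finrank_map_mulLeft _ hH0, ← hB] at e4
  have f1 := finrank_restrictTotalDegree_two n
  have f2 := finrank_restrictTotalDegree_two (n + e)
  have f3 := finrank_restrictTotalDegree_two (n + d)
  have f4 : 2 * Module.finrank ℝ (R (n + d + e)) = _ := finrank_restrictTotalDegree_two (n + d + e)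
  have key : 2 * n + (n + e + 1) * (n + e + 2) + (n + d + 1) * (n + d + 2) ≤
    (n + d + e + 1) * (n + d + e + 2) + (n + 1) * (n + 2) := by
    rw [← f1, ← f2, ← f3, ← f4]
    omega
  nlinarith [key]

/-- An irreducible polynomial divides every polynomial vanishing on infinitely many of its zeros. -/
theorem dvd_of_infinite_zeros {F H : MvPolynomial (Fin 2) ℝ} (hF : Irreducible F)
    (h : (realSolutions F H).Infinite) : F ∣ H := by
  by_contra hFH
  obtain ⟨s, hs, hc⟩ := h.exists_subset_card_eq (F.totalDegree * H.totalDegree + 1)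
  have := card_common_zeros_le hF hFH s fun p hp => hs hp
  omega

theorem encard_realSolutions_le {F H : MvPolynomial (Fin 2) ℝ} (hF : Irreducible F)
    (hFH : ¬ F ∣ H) :
    (realSolutions F H).encard ≤ (F.totalDegree * H.totalDegree : ℕ) := by
  have hfin : (realSolutions F H).Finite := by
    by_contra h
    exact hFH (dvd_of_infinite_zeros hF h)
  rw [hfin.encard_eq_coe_toFinset_card]
  exact_mod_cast card_common_zeros_le hF hFH _ fun p hp => by
    simpa [realSolutions] using hp

/-! ### Derivatives of determinants and the Desnanot–Jacobi identity. -/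

section Determinants

theorem Derivation.map_finsetProd {R A ι : Type*} [CommRing R] [CommRing A] [Algebra R A]
    [DecidableEq ι] (D : Derivation R A A) (s : Finset ι) (f : ι → A) :
    D (∏ i ∈ s, f i) = ∑ i ∈ s, (∏ j ∈ s.erase i, f j) * D (f i) := by
  induction s using Finset.induction_on with
  | empty => simp
  | insert a s ha ih =>
    rw [Finset.prod_insert ha, Derivation.leibniz, ih, Finset.sum_insert ha,
      Finset.erase_insert ha, smul_eq_mul, smul_eq_mul, Finset.mul_sum, add_comm]
    congr 1
    refine Finset.sum_congr rfl fun i hi => ?_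
    have hai : a ≠ i := fun h => ha (h ▸ hi)
    rw [Finset.erase_insert_of_ne hai, Finset.prod_insert (fun h => ha (Finset.mem_of_mem_erase h)),
      mul_assoc]

/-- A derivation acts on a determinant column by column. -/
theorem Derivation.map_det {R A n : Type*} [CommRing R] [CommRing A] [Algebra R A]
    [DecidableEq n] [Fintype n] (D : Derivation R A A) (M : Matrix n n A) :
    D M.det = ∑ j, (M.updateCol j fun i => D (M i j)).det := by
  simp only [Matrix.det_apply, map_sum]
  rw [Finset.sum_comm]
  refine Finset.sum_congr rfl fun σ _ => ?_
  rw [← Finset.smul_sum, Units.smul_def, map_zsmul, ← Units.smul_def, D.map_finsetProd]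
  congr 1
  refine Finset.sum_congr rfl fun j _ => ?_
  rw [← Finset.prod_erase_mul _ _ (Finset.mem_univ j)]
  congr 1
  · refine Finset.prod_congr rfl fun i hi => ?_
    rw [Matrix.updateCol_ne (Finset.ne_of_mem_erase hi)]
  · rw [Matrix.updateCol_self]

/-- The position `k + r` appended to the first `k` positions. -/
def borderIndex (k r : ℕ) (i : Fin (k + 1)) : ℕ := if i.1 < k then i.1 else k + r

theorem borderIndex_zero (k : ℕ) (i : Fin (k + 1)) : borderIndex k 0 i = i := by
  unfold borderIndex
  split_ifs <;> omega

/-- Schur complement of the leading block. The bracket is the entry $(r,c)$ of the complement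
appearing in `det_border_two_field`; comparing the two gives Desnanot–Jacobi. -/
theorem det_border_field {K : Type*} [Field K] (B : ℕ → ℕ → K) (k r c : ℕ)
    (P : Matrix (Fin k) (Fin k) K) (hPB : P = Matrix.of fun i j : Fin k => B i j) (hP : IsUnit P) :
    (Matrix.of fun i j => B (borderIndex k r i) (borderIndex k c j)).det =
      P.det * (B (k + r) (k + c) -
        ∑ j, (∑ i : Fin k, B (k + r) i * P⁻¹ i j) * B j (k + c)) := by
  have := hP.invertible
  rw [← Matrix.det_submatrix_equiv_self (finSumFinEquiv : Fin k ⊕ Fin 1 ≃ Fin (k + 1))]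
  have : (Matrix.of fun i j => B (borderIndex k r i) (borderIndex k c j)).submatrix
      (finSumFinEquiv : Fin k ⊕ Fin 1 ≃ Fin (k + 1)) finSumFinEquiv =
      Matrix.fromBlocks P (Matrix.of fun i _ => B i (k + c)) (Matrix.of fun _ j => B (k + r) j)
        (Matrix.of fun _ _ => B (k + r) (k + c)) := by
    subst hPB
    ext (i | i) (j | j) <;> simp [borderIndex]
  rw [this, Matrix.det_fromBlocks₁₁, Matrix.det_fin_one]
  simp [Matrix.mul_apply]

theorem det_border_two_field {K : Type*} [Field K] (B : ℕ → ℕ → K) (k : ℕ)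
    (P : Matrix (Fin k) (Fin k) K) (hPB : P = Matrix.of fun i j : Fin k => B i j) (hP : IsUnit P) :
    (Matrix.of fun i j : Fin (k + 2) => B i j).det =
      P.det * (Matrix.of fun r c : Fin 2 => (B (k + r) (k + c) -
        ∑ j, (∑ i : Fin k, B (k + r) i * P⁻¹ i j) * B j (k + c))).det := by
  have := hP.invertible
  rw [← Matrix.det_submatrix_equiv_self (finSumFinEquiv : Fin k ⊕ Fin 2 ≃ Fin (k + 2))]
  have : (Matrix.of fun i j : Fin (k + 2) => B i j).submatrix
      (finSumFinEquiv : Fin k ⊕ Fin 2 ≃ Fin (k + 2)) finSumFinEquiv =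
      Matrix.fromBlocks P (Matrix.of fun i (c : Fin 2) => B i (k + c))
        (Matrix.of fun (r : Fin 2) j => B (k + r) j)
        (Matrix.of fun r c : Fin 2 => B (k + r) (k + c)) := by
    subst hPB
    ext (i | i) (j | j) <;> simp
  rw [this, Matrix.det_fromBlocks₁₁]
  congr 2
  ext r c
  simp [Matrix.mul_apply]

/-- The Desnanot–Jacobi identity for the last two rows and columns. -/
theorem desnanot_jacobi {A : Type*} [CommRing A] [IsDomain A] (B : ℕ → ℕ → A) (k : ℕ)
    (hP : (Matrix.of fun i j : Fin k => B i j).det ≠ 0) :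
    (Matrix.of fun i j : Fin k => B i j).det * (Matrix.of fun i j : Fin (k + 2) => B i j).det =
      (Matrix.of fun i j => B (borderIndex k 0 i) (borderIndex k 0 j)).det *
        (Matrix.of fun i j => B (borderIndex k 1 i) (borderIndex k 1 j)).det -
      (Matrix.of fun i j => B (borderIndex k 0 i) (borderIndex k 1 j)).det *
        (Matrix.of fun i j => B (borderIndex k 1 i) (borderIndex k 0 j)).det := by
  -- In the fraction field the leading block becomes invertible.
  let φ := algebraMap A (FractionRing A)
  have hφ : Function.Injective φ := IsFractionRing.injective A (FractionRing A)
  have hmap : ∀ {n : ℕ} (ρ κ : Fin n → ℕ), φ (Matrix.of fun i j => B (ρ i) (κ j)).det =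
      (Matrix.of fun i j => φ (B (ρ i) (κ j))).det := fun ρ κ => by
    rw [RingHom.map_det]; rfl
  apply hφ
  have hP' : IsUnit (Matrix.of fun i j : Fin k => φ (B i j)) := by
    rw [Matrix.isUnit_iff_isUnit_det, isUnit_iff_ne_zero, ← hmap]
    exact fun h => hP (hφ (by rw [h, map_zero]))
  simp only [map_mul, map_sub, hmap]
  rw [det_border_two_field (fun i j => φ (B i j)) k _ rfl hP',
    det_border_field (fun i j => φ (B i j)) k 0 0 _ rfl hP',
    det_border_field (fun i j => φ (B i j)) k 0 1 _ rfl hP',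
    det_border_field (fun i j => φ (B i j)) k 1 0 _ rfl hP',
    det_border_field (fun i j => φ (B i j)) k 1 1 _ rfl hP', Matrix.det_fin_two]
  simp only [Matrix.of_apply, Fin.val_zero, Fin.val_one]
  ring

end Determinants

/-! ### Wronskians for a derivation on an algebra. -/

section Wronskian

variable {A : Type*} [CommRing A] [Algebra ℝ A]

/-- The Wronskian of `f 0, …, f (n - 1)` with respect to the derivation `D`. -/
def derivationWronskian (D : Derivation ℝ A A) (f : ℕ → A) (n : ℕ) : A :=
  (Matrix.of fun i j : Fin n => D^[j] (f i)).det

/-- The Wronskian of `f 0, …, f (n - 1), g`. -/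
def snocWronskian (D : Derivation ℝ A A) (f : ℕ → A) (n : ℕ) (g : A) : A :=
  derivationWronskian D (fun i => if i < n then f i else g) (n + 1)

theorem derivationWronskian_zero (D : Derivation ℝ A A) (f : ℕ → A) :
    derivationWronskian D f 0 = 1 := by
  simp [derivationWronskian]

theorem derivationWronskian_congr (D : Derivation ℝ A A) {f g : ℕ → A} {n : ℕ}
    (h : ∀ i < n, f i = g i) : derivationWronskian D f n = derivationWronskian D g n := by
  unfold derivationWronskian
  congr 1
  ext i j
  simp [h i i.2]

theorem snocWronskian_self (D : Derivation ℝ A A) (f : ℕ → A) (n : ℕ) :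
    snocWronskian D f n (f n) = derivationWronskian D f (n + 1) := by
  refine derivationWronskian_congr D fun i hi => ?_
  split_ifs with h
  · rfl
  · rw [show i = n by omega]

theorem snocWronskian_zero (D : Derivation ℝ A A) (f : ℕ → A) (g : A) :
    snocWronskian D f 0 g = g := by
  simp [snocWronskian, derivationWronskian]

theorem snocWronskian_of_lt (D : Derivation ℝ A A) (f : ℕ → A) {n i : ℕ} (h : i < n) :
    snocWronskian D f n (f i) = 0 := by
  unfold snocWronskian derivationWronskian
  refine Matrix.det_zero_of_row_eq (i := ⟨i, by omega⟩) (j := Fin.last n)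
    (fun h' => by simp [Fin.ext_iff] at h'; omega) ?_
  ext j
  simp [h]

theorem snocWronskian_eq_updateRow (D : Derivation ℝ A A) (f : ℕ → A) (n : ℕ) (g : A) :
    snocWronskian D f n g = ((Matrix.of fun i j : Fin (n + 1) => D^[j] (f i)).updateRow (Fin.last n)
      fun j => D^[j] g).det := by
  unfold snocWronskian derivationWronskian
  congr 1
  ext i j
  rw [Matrix.updateRow_apply]
  rcases Fin.eq_castSucc_or_eq_last i with ⟨i, rfl⟩ | rfl
  · simp [Fin.castSucc_ne_last]
  · simp

theorem snocWronskian_add (D : Derivation ℝ A A) (f : ℕ → A) (n : ℕ) (g h : A) :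
    snocWronskian D f n (g + h) = snocWronskian D f n g + snocWronskian D f n h := by
  simp only [snocWronskian_eq_updateRow]
  rw [← Matrix.det_updateRow_add]
  congr 2
  ext j
  simp [iterate_map_add]

theorem snocWronskian_smul (D : Derivation ℝ A A) (f : ℕ → A) (n : ℕ) (c : ℝ) (g : A) :
    snocWronskian D f n (c • g) = c • snocWronskian D f n g := by
  simp only [snocWronskian_eq_updateRow]
  rw [Algebra.smul_def c (Matrix.det _), ← Matrix.det_updateRow_smul]
  congr 2
  ext j
  rw [Pi.smul_apply, smul_eq_mul, ← Algebra.smul_def]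
  rw [← Derivation.coeFn_coe, ← Module.End.coe_pow, map_smul]

/-- The Wronskian `g ↦ W (f 0, …, f (n - 1), g)` as a linear map. -/
def snocWronskianₗ (D : Derivation ℝ A A) (f : ℕ → A) (n : ℕ) : A →ₗ[ℝ] A where
  toFun := snocWronskian D f n
  map_add' := snocWronskian_add D f n
  map_smul' := snocWronskian_smul D f n

/-- The terms with $i<n$ repeat a row, so only the last survives. This is where the Rolle induction
ends. -/
theorem snocWronskian_sum (D : Derivation ℝ A A) (f : ℕ → A) (n : ℕ) (c : ℕ → ℝ) :
    snocWronskian D f n (∑ i ∈ Finset.range (n + 1), c i • f i) =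
      c n • derivationWronskian D f (n + 1) := by
  change snocWronskianₗ D f n _ = _
  rw [map_sum, Finset.sum_range_succ, Finset.sum_eq_zero, zero_add, map_smul]
  · rw [← snocWronskian_self]; rfl
  · intro i hi
    rw [map_smul]
    change _ • snocWronskian D f n (f i) = 0
    rw [snocWronskian_of_lt D f (Finset.mem_range.mp hi), smul_zero]

theorem snocWronskian_sub_smul (D : Derivation ℝ A A) (f : ℕ → A) (n : ℕ) (c : ℝ) (g : A) :
    snocWronskian D f n (g - c • f n) =
      snocWronskian D f n g - c • derivationWronskian D f (n + 1) := by
  rw [← snocWronskian_self]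
  change snocWronskianₗ D f n _ = _
  rw [map_sub, map_smul]
  rfl

/-- Differentiating a Wronskian raises the order of its last column. -/
theorem derivation_derivationWronskian (D : Derivation ℝ A A) (f : ℕ → A) (k : ℕ) :
    D (derivationWronskian D f (k + 1)) =
      (Matrix.of fun i j : Fin (k + 1) => D^[borderIndex k 1 j] (f i)).det := by
  unfold derivationWronskian
  rw [D.map_det, Fin.sum_univ_castSucc, Finset.sum_eq_zero, zero_add]
  · congr 1
    ext i j
    rw [Matrix.updateCol_apply]
    rcases Fin.eq_castSucc_or_eq_last j with ⟨j, rfl⟩ | rfl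
    · simp [Fin.castSucc_ne_last, borderIndex]
    · simp [borderIndex, Function.iterate_succ_apply']
  -- Differentiating any column but the last makes it equal to the next one.
  · intro j _
    refine Matrix.det_zero_of_column_eq (i := j.castSucc) (j := j.succ)
      Fin.castSucc_lt_succ.ne fun i => ?_
    rw [Matrix.updateCol_self, Matrix.updateCol_ne Fin.castSucc_lt_succ.ne']
    simp [Function.iterate_succ_apply']

/-- The numerator of $D\bigl(W(f_0,\dots,f_{k-1},g)/W_{k+1}\bigr)$. It is Desnanot–Jacobi for the
Wronskian matrix of $f_0,\dots,f_k,g$: minors using the last column order $k+1$ in place of $k$ are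
derivatives of Wronskians. -/
theorem snocWronskian_identity [IsDomain A] (D : Derivation ℝ A A) (f : ℕ → A) (k : ℕ) (g : A)
    (hk : derivationWronskian D f k ≠ 0) :
    D (snocWronskian D f k g) * derivationWronskian D f (k + 1) -
      snocWronskian D f k g * D (derivationWronskian D f (k + 1)) =
    derivationWronskian D f k * snocWronskian D f (k + 1) g := by
  let s : ℕ → A := fun i => if i < k + 1 then f i else g
  have e0 : derivationWronskian D f k = derivationWronskian D s k :=
    derivationWronskian_congr D fun i hi => by
      simp only [s, if_pos (show i < k + 1 by omega)]
  have e1 : derivationWronskian D f (k + 1) = derivationWronskian D s (k + 1) :=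
    derivationWronskian_congr D fun i hi => by
      simp only [s, if_pos hi]
  have e2 : snocWronskian D f k g =
      derivationWronskian D (fun i => if i < k then s i else s (k + 1)) (k + 1) :=
    derivationWronskian_congr D fun i hi => by
      by_cases h : i < k
      · simp only [s, if_pos h, if_pos (show i < k + 1 by omega)]
      · simp [s, h]
  have e3 : snocWronskian D f (k + 1) g = derivationWronskian D s (k + 2) := rfl
  rw [e1, e2, e3]
  rw [e0] at hk ⊢
  rw [derivation_derivationWronskian, derivation_derivationWronskian]
  have := desnanot_jacobi (fun i j => D^[j] (s i)) k hk
  unfold derivationWronskian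
  rw [this]
  have hb : ∀ i : Fin (k + 1), (if i.1 < k then s i else s (k + 1)) = s (borderIndex k 1 i) :=
    fun i => by unfold borderIndex; split_ifs <;> rfl
  simp only [borderIndex_zero, hb]
  ring

end Wronskian

/-! ### The tangent derivation and its degree estimates. -/

section HamiltonianDerivation

/-- The derivation `X Y (F_Y ∂_X - F_X ∂_Y)`, tangent to the curve `F = 0`. -/
noncomputable def tangentDerivation (F : MvPolynomial (Fin 2) ℝ) :
    Derivation ℝ (MvPolynomial (Fin 2) ℝ) (MvPolynomial (Fin 2) ℝ) :=
  (X 0 * X 1 * pderiv 1 F) • pderiv 0 - (X 0 * X 1 * pderiv 0 F) • pderiv 1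

theorem tangentDerivation_apply (F P : MvPolynomial (Fin 2) ℝ) :
    tangentDerivation F P =
      X 0 * X 1 * pderiv 1 F * pderiv 0 P - X 0 * X 1 * pderiv 0 F * pderiv 1 P := by
  simp [tangentDerivation]

theorem totalDegree_pderiv_add_one_le {σ : Type*} (i : σ) (P : MvPolynomial σ ℝ)
    (h : pderiv i P ≠ 0) : (pderiv i P).totalDegree + 1 ≤ P.totalDegree := by
  classical
  obtain ⟨m, hm, hdeg⟩ := Finset.exists_mem_eq_sup (pderiv i P).support (support_nonempty.mpr h)
    fun s => s.sum fun _ e => e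
  have hm' : m + Finsupp.single i 1 ∈ P.support := by
    rw [mem_support_iff, coeff_pderiv] at hm
    exact mem_support_iff.mpr (left_ne_zero_of_mul hm)
  have h1 := le_totalDegree hm'
  have h2 : (pderiv i P).totalDegree = m.sum fun _ e => e := hdeg
  rw [h2]
  rw [Finsupp.sum_add_index' (by simp) (by simp)] at h1
  simpa using h1

/-- The two partial derivatives lose the two degrees that $XY$ adds, so $D$ raises degrees by at
most $\deg F$. -/
theorem totalDegree_X_mul_X_mul_pderiv_le (F P : MvPolynomial (Fin 2) ℝ) (i j : Fin 2) :
    (X 0 * X 1 * pderiv i F * pderiv j P).totalDegree ≤ F.totalDegree + P.totalDegree := by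
  by_cases h : pderiv i F = 0
  · simp [h]
  by_cases h' : pderiv j P = 0
  · simp [h']
  have h1 := totalDegree_pderiv_add_one_le i F h
  have h2 := totalDegree_pderiv_add_one_le j P h'
  have h3 := totalDegree_mul (X 0 * X 1 * pderiv i F) (pderiv j P)
  have h4 := totalDegree_mul (X 0 * X 1 : MvPolynomial (Fin 2) ℝ) (pderiv i F)
  have h5 := totalDegree_mul (X 0 : MvPolynomial (Fin 2) ℝ) (X 1)
  rw [totalDegree_X, totalDegree_X] at h5
  omega

theorem totalDegree_X_mul_pderiv_le (F : MvPolynomial (Fin 2) ℝ) (c : ℝ) (i j : Fin 2) :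
    (C c * (X i * pderiv j F)).totalDegree ≤ F.totalDegree := by
  by_cases h : pderiv j F = 0
  · simp [h]
  have h1 := totalDegree_pderiv_add_one_le j F h
  have h2 := totalDegree_mul (C c) (X i * pderiv j F)
  have h3 := totalDegree_mul (X i) (pderiv j F)
  rw [totalDegree_X] at h3
  rw [totalDegree_C] at h2
  omega

/-- The iterates of the tangent derivation at a monomial. -/
theorem exists_iterate_tangentDerivation_monomial (F : MvPolynomial (Fin 2) ℝ)
    (m : Fin 2 →₀ ℕ) (n : ℕ) :
    ∃ P : MvPolynomial (Fin 2) ℝ, (tangentDerivation F)^[n] (monomial m 1) = monomial m 1 * P ∧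
      P.totalDegree ≤ n * F.totalDegree := by
  induction n with
  | zero => exact ⟨1, by simp, by simp⟩
  | succ n ih =>
    obtain ⟨P, hP, hdeg⟩ := ih
    -- The Leibniz rule: $Dx^m=x^m(m_0YF_Y-m_1XF_X)$, since $X\partial_X$ and $Y\partial_Y$ only
    -- scale monomials. The exponents enter as scalars, hence not in the degree.
    refine ⟨X 0 * X 1 * pderiv 1 F * pderiv 0 P - X 0 * X 1 * pderiv 0 F * pderiv 1 P +
      (C (m 0 : ℝ) * (X 1 * pderiv 1 F) - C (m 1 : ℝ) * (X 0 * pderiv 0 F)) * P, ?_, ?_⟩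
    · have h0 : X 0 * pderiv 0 (monomial m (1 : ℝ)) = C (m 0 : ℝ) * monomial m 1 := by
        rw [X_mul_pderiv_monomial, nsmul_eq_mul, C_eq_coe_nat]
      have h1 : X 1 * pderiv 1 (monomial m (1 : ℝ)) = C (m 1 : ℝ) * monomial m 1 := by
        rw [X_mul_pderiv_monomial, nsmul_eq_mul, C_eq_coe_nat]
      rw [Function.iterate_succ_apply', hP, tangentDerivation_apply, pderiv_mul, pderiv_mul]
      linear_combination (X 1 * pderiv 1 F * P) * h0 - (X 0 * pderiv 0 F * P) * h1
    · refine (totalDegree_add _ _).trans (max_le ((totalDegree_sub _ _).trans (max_le ?_ ?_)) ?_)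
      · exact (totalDegree_X_mul_X_mul_pderiv_le F P 1 0).trans (by linarith)
      · exact (totalDegree_X_mul_X_mul_pderiv_le F P 0 1).trans (by linarith)
      · have := (totalDegree_sub (C (m 0 : ℝ) * (X 1 * pderiv 1 F))
          (C (m 1 : ℝ) * (X 0 * pderiv 0 F))).trans (max_le
          (totalDegree_X_mul_pderiv_le F _ _ _) (totalDegree_X_mul_pderiv_le F _ _ _))
        exact (totalDegree_mul _ _).trans (by linarith)

/-- A Wronskian of monomials is a monomial times a polynomial of small degree. -/
theorem exists_wronskian_monomial_eq (F : MvPolynomial (Fin 2) ℝ) (m : ℕ → Fin 2 →₀ ℕ) (n : ℕ) :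
    ∃ T : MvPolynomial (Fin 2) ℝ,
      derivationWronskian (tangentDerivation F) (fun i => monomial (m i) 1) n =
        (∏ i : Fin n, monomial (m i) 1) * T ∧
      T.totalDegree ≤ n * n * F.totalDegree := by
  choose P hP hdeg using fun i j => exists_iterate_tangentDerivation_monomial F (m i) j
  refine ⟨(Matrix.of fun i j : Fin n => P i j).det, ?_, ?_⟩
  · unfold derivationWronskian
    rw [← Matrix.det_mul_column]
    congr 1
    ext1 i j
    simp [hP]
  · rw [Matrix.det_apply']
    refine totalDegree_finsetSum_le fun σ _ => ?_
    have h1 : ((Equiv.Perm.sign σ : ℤ) : MvPolynomial (Fin 2) ℝ).totalDegree = 0 := by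
      rcases Int.units_eq_one_or (Equiv.Perm.sign σ) with h | h <;> simp [h]
    refine (totalDegree_mul _ _).trans ?_
    rw [h1, zero_add]
    refine (totalDegree_finsetProd _ _).trans ((Finset.sum_le_card_nsmul _ _ (n * F.totalDegree)
      fun i _ => ?_).trans ?_)
    · exact (hdeg _ _).trans (Nat.mul_le_mul_right _ i.2.le)
    · simp [mul_assoc]

end HamiltonianDerivation

/-! ### Differentiation along a plane curve. -/

section Curves

/-- The chain rule for a polynomial along a graph. -/
theorem hasDerivAt_eval_graph (P : MvPolynomial (Fin 2) ℝ) {φ : ℝ → ℝ} {φ' x : ℝ}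
    (hφ : HasDerivAt φ φ' x) :
    HasDerivAt (fun s => eval ![s, φ s] P)
      (eval ![x, φ x] (pderiv 0 P) + eval ![x, φ x] (pderiv 1 P) * φ') x := by
  induction P using MvPolynomial.induction_on with
  | C a => simpa using hasDerivAt_const x a
  | add p q hp hq =>
    convert! hp.add hq using 1
    · ext s; simp
    · simp only [map_add]; ring
  | mul_X p i hp =>
    fin_cases i
    · convert! hp.mul (hasDerivAt_id x) using 1
      · ext s; simp
      · simp; ring
    · convert! hp.mul hφ using 1
      · ext s; simp
      · simp; ring

theorem continuous_eval_pair (P : MvPolynomial (Fin 2) ℝ) :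
    Continuous fun p : ℝ × ℝ => eval ![p.1, p.2] P :=
  (MvPolynomial.continuous_eval P).comp (by fun_prop)

/-- First order Taylor expansion of a polynomial at a point, with polynomial coefficients. -/
theorem exists_hadamard (P : MvPolynomial (Fin 2) ℝ) (a b : ℝ) :
    ∃ A B : MvPolynomial (Fin 2) ℝ,
      (∀ x y, eval ![x, y] P =
        eval ![a, b] P + (x - a) * eval ![x, y] A + (y - b) * eval ![x, y] B) ∧
      eval ![a, b] A = eval ![a, b] (pderiv 0 P) ∧
      eval ![a, b] B = eval ![a, b] (pderiv 1 P) := by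
  induction P using MvPolynomial.induction_on with
  | C c => exact ⟨0, 0, by simp, by simp, by simp⟩
  | add p q hp hq =>
    obtain ⟨A, B, h, hA, hB⟩ := hp
    obtain ⟨A', B', h', hA', hB'⟩ := hq
    refine ⟨A + A', B + B', fun x y => ?_, by simp [hA, hA'], by simp [hB, hB']⟩
    simp only [map_add]
    rw [h x y, h' x y]
    ring
  | mul_X p i hp =>
    obtain ⟨A, B, h, hA, hB⟩ := hp
    fin_cases i
    · refine ⟨C (eval ![a, b] p) + A * X 0, B * X 0, fun x y => ?_, ?_, ?_⟩
      · simp [h x y]; ring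
      · simp [hA]; ring
      · simp [hB]; ring
    · refine ⟨A * X 1, C (eval ![a, b] p) + B * X 1, fun x y => ?_, ?_, ?_⟩
      · simp [h x y]; ring
      · simp [hA]; ring
      · simp [hB]; ring

/-- A continuous solution of `F (x, φ x) = 0` with `F_Y ≠ 0` is differentiable. -/
theorem hasDerivAt_of_continuousAt_of_eval_eq_zero (F : MvPolynomial (Fin 2) ℝ) {φ : ℝ → ℝ}
    {a : ℝ} (hφ : ContinuousAt φ a) (hF : ∀ᶠ x in nhds a, eval ![x, φ x] F = 0)
    (hFy : eval ![a, φ a] (pderiv 1 F) ≠ 0) :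
    HasDerivAt φ (-eval ![a, φ a] (pderiv 0 F) / eval ![a, φ a] (pderiv 1 F)) a := by
  obtain ⟨A, B, h, hA, hB⟩ := exists_hadamard F a (φ a)
  have hcont : ∀ P : MvPolynomial (Fin 2) ℝ, ContinuousAt (fun x => eval ![x, φ x] P) a :=
    fun P => ContinuousAt.comp (f := fun x => (x, φ x)) (continuous_eval_pair P).continuousAt
      (continuousAt_id.prodMk hφ)
  have hB0 : ∀ᶠ x in nhds a, eval ![x, φ x] B ≠ 0 :=
    (hcont B).eventually_ne (by rw [hB]; exact hFy)
  rw [hasDerivAt_iff_tendsto_slope, ← hA, ← hB]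
  have hlim : Filter.Tendsto (fun x => -eval ![x, φ x] A / eval ![x, φ x] B) (nhdsWithin a {a}ᶜ)
      (nhds (-eval ![a, φ a] A / eval ![a, φ a] B)) :=
    (((hcont A).neg.div (hcont B) (by rw [hB]; exact hFy)).tendsto).mono_left nhdsWithin_le_nhds
  -- On the curve $0=(x-a)A+(\varphi(x)-\varphi(a))B$, so the slope is exactly $-A/B$.
  refine hlim.congr' ?_
  filter_upwards [nhdsWithin_le_nhds hB0, nhdsWithin_le_nhds hF, self_mem_nhdsWithin]
    with x hx hx' hxa
  have hxa' : x - a ≠ 0 := sub_ne_zero.mpr hxa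
  have h1 := h x (φ x)
  rw [hx', hF.self_of_nhds] at h1
  rw [slope_def_field, div_eq_div_iff hx hxa']
  linarith

end Curves

/-! ### Local boundedness of the fibers. -/

section LeadingCoefficient

-- $F$ read as a polynomial in $Y$ over $\mathbb{R}[X]$; the leading coefficient controls the escape
-- of roots to infinity.
open Polynomial in
theorem exists_fiber_expansion (F : MvPolynomial (Fin 2) ℝ) (hF : F ≠ 0) :
    ∃ (n : ℕ) (a : ℕ → ℝ[X]), a n ≠ 0 ∧ (∀ j, (a j).natDegree ≤ F.totalDegree) ∧
      ∀ x y, MvPolynomial.eval ![x, y] F =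
        ∑ j ∈ Finset.range (n + 1), (a j).eval x * y ^ j := by
  let P : ℝ[X][X] := MvPolynomial.aeval ![Polynomial.C Polynomial.X, Polynomial.X] F
  have hP : ∀ x y, MvPolynomial.eval ![x, y] F = P.evalEval x y := by
    intro x y
    have : (Polynomial.evalEvalRingHom x y).comp (MvPolynomial.aeval (R := ℝ)
        ![(Polynomial.C Polynomial.X : ℝ[X][X]), Polynomial.X]).toRingHom =
        MvPolynomial.eval ![x, y] := by
      refine MvPolynomial.ringHom_ext (fun r => ?_) fun i => ?_
      · simp [Polynomial.algebraMap_apply]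
      · fin_cases i <;> simp
    exact (congrArg (fun g => g F) this).symm
  refine ⟨P.natDegree, P.coeff, ?_, fun j => ?_, fun x y => ?_⟩
  · rw [Polynomial.coeff_natDegree, Polynomial.leadingCoeff_ne_zero]
    intro h0
    refine hF (MvPolynomial.funext fun p => ?_)
    have h1 := hP (p 0) (p 1)
    rw [h0] at h1
    have h2 : ![p 0, p 1] = p := by ext i; fin_cases i <;> rfl
    simpa [h2] using h1
  · have : P = ∑ d ∈ F.support, Polynomial.C (Polynomial.C (F.coeff d) * Polynomial.X ^ d 0) *
        Polynomial.X ^ d 1 := by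
      simp only [P, MvPolynomial.aeval_def, MvPolynomial.eval₂_eq', Fin.prod_univ_two]
      refine Finset.sum_congr rfl fun d _ => ?_
      simp [Polynomial.algebraMap_apply, mul_assoc]
    rw [this, Polynomial.finsetSum_coeff]
    refine Polynomial.natDegree_sum_le_of_forall_le _ _ fun d hd => ?_
    rw [Polynomial.coeff_C_mul_X_pow]
    split_ifs
    · refine (Polynomial.natDegree_C_mul_X_pow_le _ _).trans ?_
      refine le_trans ?_ (MvPolynomial.le_totalDegree hd)
      rw [Finsupp.sum_fintype _ _ (by simp)]
      simp
    · simp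
  · rw [hP, Polynomial.evalEval, Polynomial.eval_eq_sum_range (p := P), Polynomial.eval_finsetSum]
    simp

open Polynomial in
/-- The fibers of a plane curve are locally bounded away from the zeros of a leading
coefficient. -/
theorem exists_fibers_locally_bounded (F : MvPolynomial (Fin 2) ℝ) (hF : F ≠ 0) :
    ∃ q : ℝ[X], q ≠ 0 ∧ q.natDegree ≤ F.totalDegree ∧ ∀ a, q.eval a ≠ 0 →
      ∃ M, ∀ᶠ x in nhds a, ∀ y, MvPolynomial.eval ![x, y] F = 0 → |y| ≤ M := by
  obtain ⟨n, c, hn, hdeg, h⟩ := exists_fiber_expansion F hF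
  refine ⟨c n, hn, hdeg n, fun a ha => ?_⟩
  let S : ℝ → ℝ := fun x => ∑ j ∈ Finset.range n, |(c j).eval x|
  -- Cauchy's root bound: a root with $|y|>1$ satisfies $|c_n||y|\le S$. The bound is continuous in
  -- $x$ near `a`.
  have hcont : ContinuousAt (fun x => 1 + S x / |(c n).eval x|) a := by
    refine continuousAt_const.add (ContinuousAt.div ?_ ?_ (abs_ne_zero.mpr ha))
    · exact (continuous_finsetSum _ fun j _ => (c j).continuous.abs).continuousAt
    · exact (c n).continuous.abs.continuousAt
  refine ⟨1 + S a / |(c n).eval a| + 1, ?_⟩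
  filter_upwards [hcont.eventually_lt_const (lt_add_one _),
    (c n).continuous.continuousAt.eventually_ne ha] with x hx hx0 y hy
  refine le_trans ?_ hx.le
  have hS : 0 ≤ S x := Finset.sum_nonneg fun j _ => abs_nonneg _
  have hpos : 0 < |(c n).eval x| := abs_pos.mpr hx0
  by_cases hy1 : |y| ≤ 1
  · exact hy1.trans (le_add_of_nonneg_right (by positivity))
  push Not at hy1
  rw [h, Finset.sum_range_succ] at hy
  have h1 : |(c n).eval x| * |y| ^ n ≤ ∑ j ∈ Finset.range n, |(c j).eval x| * |y| ^ j := by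
    have : (c n).eval x * y ^ n = -∑ j ∈ Finset.range n, (c j).eval x * y ^ j := by linarith
    rw [← abs_pow, ← abs_mul, this, abs_neg]
    refine (Finset.abs_sum_le_sum_abs _ _).trans_eq ?_
    simp [abs_mul, abs_pow]
  have h2 : (∑ j ∈ Finset.range n, |(c j).eval x| * |y| ^ j) * |y| ≤ S x * |y| ^ n := by
    simp only [S, Finset.sum_mul]
    refine Finset.sum_le_sum fun j hj => ?_
    rw [mul_assoc, ← pow_succ]
    exact mul_le_mul_of_nonneg_left (pow_le_pow_right₀ hy1.le (Finset.mem_range.mp hj))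
      (abs_nonneg _)
  have h3 : |(c n).eval x| * |y| ≤ S x := by
    have hyn : 0 < |y| ^ n := by positivity
    have := (mul_le_mul_of_nonneg_right h1 (abs_nonneg y)).trans h2
    refine le_of_mul_le_mul_right ?_ hyn
    linarith
  have h4 : |y| ≤ S x / |(c n).eval x| := by
    rw [le_div_iff₀ hpos]
    linarith
  linarith

end LeadingCoefficient

/-! ### Continuity of roots and the branches over an interval. -/

section LocalStructure

open Filter Topology

theorem hasDerivAt_eval_fiber (F : MvPolynomial (Fin 2) ℝ) (x z : ℝ) :
    HasDerivAt (fun z => eval ![x, z] F) (eval ![x, z] (pderiv 1 F)) z := by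
  obtain ⟨A, B, h, -, hB⟩ := exists_hadamard F x z
  rw [← hB, hasDerivAt_iff_tendsto_slope]
  have hc : ContinuousAt (fun y => eval ![x, y] B) z :=
    ((continuous_eval_pair B).comp (f := fun y : ℝ => (x, y)) (by fun_prop)).continuousAt
  refine (hc.tendsto.mono_left nhdsWithin_le_nhds).congr' ?_
  filter_upwards [self_mem_nhdsWithin] with y hy
  have hy' : y - z ≠ 0 := sub_ne_zero.mpr hy
  rw [slope_def_field, h x y]
  field_simp
  ring

/-- Existence is a sign change between $b-\varepsilon/2$ and $b+\varepsilon/2$, stable under moving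
$x$. Uniqueness is Rolle, as $F_Y\ne0$ near $(a,b)$. -/
theorem eventually_existsUnique_root (F : MvPolynomial (Fin 2) ℝ) {a b : ℝ}
    (hF : eval ![a, b] F = 0) (hFy : eval ![a, b] (pderiv 1 F) ≠ 0) :
    ∀ᶠ ε in 𝓝[>] (0 : ℝ), ∀ᶠ x in 𝓝 a, ∃! z, |z - b| < ε ∧ eval ![x, z] F = 0 := by
  obtain ⟨A, B, h, -, hB⟩ := exists_hadamard F a b
  have hFy' : ∀ᶠ p in 𝓝 (a, b), eval ![p.1, p.2] (pderiv 1 F) ≠ 0 :=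
    (continuous_eval_pair (pderiv 1 F)).continuousAt.eventually_ne hFy
  obtain ⟨δ, hδ, hball⟩ := Metric.eventually_nhds_iff.mp hFy'
  -- As $F(a,b\pm\varepsilon/2)=\pm(\varepsilon/2)B(a,b\pm\varepsilon/2)$, equal signs of $B$ mean
  -- opposite signs of $F$.
  have hpos : ∀ᶠ ε in 𝓝 (0 : ℝ), 0 < eval ![a, b - ε / 2] B * eval ![a, b + ε / 2] B := by
    have hc : Continuous fun ε : ℝ => eval ![a, b - ε / 2] B * eval ![a, b + ε / 2] B :=
      ((continuous_eval_pair B).comp (f := fun ε : ℝ => (a, b - ε / 2)) (by fun_prop)).mul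
        ((continuous_eval_pair B).comp (f := fun ε : ℝ => (a, b + ε / 2)) (by fun_prop))
    refine hc.continuousAt.eventually_const_lt ?_
    simp only [zero_div, sub_zero, add_zero]
    rw [hB]
    exact mul_self_pos.mpr hFy
  filter_upwards [nhdsWithin_le_nhds hpos, nhdsWithin_le_nhds (eventually_lt_nhds hδ),
    self_mem_nhdsWithin] with ε hε hεδ hε0
  have hε0' : (0 : ℝ) < ε := hε0
  have hneg : ∀ᶠ x in 𝓝 a, eval ![x, b - ε / 2] F * eval ![x, b + ε / 2] F < 0 := by
    have hc : Continuous fun x : ℝ => eval ![x, b - ε / 2] F * eval ![x, b + ε / 2] F :=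
      ((continuous_eval_pair F).comp (f := fun x : ℝ => (x, b - ε / 2)) (by fun_prop)).mul
        ((continuous_eval_pair F).comp (f := fun x : ℝ => (x, b + ε / 2)) (by fun_prop))
    refine hc.continuousAt.eventually_lt_const ?_
    dsimp only
    rw [h a (b - ε / 2), h a (b + ε / 2), hF]
    have := mul_pos (mul_pos hε0' hε0') hε
    nlinarith
  filter_upwards [hneg, Metric.ball_mem_nhds a hδ] with x hx hxδ
  have hderiv := hasDerivAt_eval_fiber F x
  have hcont : Continuous fun z => eval ![x, z] F :=
    continuous_iff_continuousAt.mpr fun z => (hderiv z).continuousAt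
  have hroot : ∃ z ∈ Set.Icc (b - ε / 2) (b + ε / 2), eval ![x, z] F = 0 := by
    have hle : b - ε / 2 ≤ b + ε / 2 := by linarith
    rcases mul_neg_iff.mp hx with ⟨h1, h2⟩ | ⟨h1, h2⟩
    · exact intermediate_value_Icc' hle hcont.continuousOn ⟨h2.le, h1.le⟩
    · exact intermediate_value_Icc hle hcont.continuousOn ⟨h1.le, h2.le⟩
  obtain ⟨z, ⟨hz1, hz2⟩, hz⟩ := hroot
  have hlt : ∀ z₁ z₂, |z₁ - b| < ε → |z₂ - b| < ε → eval ![x, z₁] F = 0 →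
      eval ![x, z₂] F = 0 → ¬ z₁ < z₂ := by
    intro z₁ z₂ h₁ h₂ e₁ e₂ hlt
    obtain ⟨w, hw, hw0⟩ := exists_hasDerivAt_eq_zero hlt hcont.continuousOn
      (by simp only [e₁, e₂]) fun y _ => hderiv y
    rw [abs_lt] at h₁ h₂
    refine hball (y := (x, w)) ?_ hw0
    rw [Prod.dist_eq, max_lt_iff]
    refine ⟨hxδ, ?_⟩
    rw [Real.dist_eq, abs_lt]
    exact ⟨by linarith [hw.1], by linarith [hw.2]⟩
  refine ⟨z, ⟨by rw [abs_lt]; constructor <;> linarith, hz⟩, ?_⟩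
  rintro w ⟨hw1, hw2⟩
  have hz1 : |z - b| < ε := by rw [abs_lt]; constructor <;> linarith
  exact le_antisymm (not_lt.mp (hlt z w hz1 hw1 hz hw2)) (not_lt.mp (hlt w z hw1 hz1 hw2 hz))

/-- Compactness: $F(a,\cdot)$ has no zero in the part of $[-M,M]$ at distance at least $\varepsilon$
from all `r k`, and this persists for nearby $x$. -/
theorem eventually_roots_near (F : MvPolynomial (Fin 2) ℝ) {a M : ℝ} {n : ℕ} {r : Fin n → ℝ}
    (hr : ∀ y, eval ![a, y] F = 0 → ∃ k, r k = y)
    (hM : ∀ᶠ x in 𝓝 a, ∀ y, eval ![x, y] F = 0 → |y| ≤ M) {ε : ℝ} (hε : 0 < ε) :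
    ∀ᶠ x in 𝓝 a, ∀ y, eval ![x, y] F = 0 → ∃ k, |y - r k| < ε := by
  let K : Set ℝ := Metric.closedBall 0 M ∩ ⋂ k, {y | ε ≤ |y - r k|}
  have hK : IsCompact K := (isCompact_closedBall _ _).inter_right
    (isClosed_iInter fun k => isClosed_le continuous_const (by fun_prop))
  have h1 : ∀ᶠ x in 𝓝 a, ∀ y ∈ K, eval ![x, y] F ≠ 0 := by
    refine hK.eventually_forall_of_forall_eventually fun y hy => ?_
    refine (continuous_eval_pair F).continuousAt.eventually_ne fun h0 => ?_
    obtain ⟨k, rfl⟩ := hr y h0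
    have := Set.mem_iInter.mp hy.2 k
    simp only [Set.mem_ofPred_eq, sub_self, abs_zero] at this
    linarith
  filter_upwards [h1, hM] with x hx hxM y hy
  by_contra hcon
  push Not at hcon
  exact hx y ⟨by simpa using hxM y hy, Set.mem_iInter.mpr hcon⟩ hy

/-- Near a point over which all roots are simple, the roots move continuously. -/
theorem eventually_roots_enumeration (F : MvPolynomial (Fin 2) ℝ) {a M : ℝ} {n : ℕ}
    {r : Fin n → ℝ} (hmono : StrictMono r) (hr : ∀ y, eval ![a, y] F = 0 ↔ ∃ k, r k = y)
    (hFy : ∀ y, eval ![a, y] F = 0 → eval ![a, y] (pderiv 1 F) ≠ 0)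
    (hM : ∀ᶠ x in 𝓝 a, ∀ y, eval ![x, y] F = 0 → |y| ≤ M) {ε : ℝ} (hε : 0 < ε) :
    ∀ᶠ x in 𝓝 a, ∃ z : Fin n → ℝ, StrictMono z ∧ (∀ k, |z k - r k| < ε) ∧
      ∀ y, eval ![x, y] F = 0 ↔ ∃ k, z k = y := by
  have h1 : ∀ᶠ η in 𝓝[>] (0 : ℝ), ∀ k, ∀ᶠ x in 𝓝 a, ∃! z, |z - r k| < η ∧ eval ![x, z] F = 0 :=
    eventually_all.mpr fun k => eventually_existsUnique_root F ((hr _).mpr ⟨k, rfl⟩)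
      (hFy _ ((hr _).mpr ⟨k, rfl⟩))
  -- Windows of radius below half of every gap are disjoint, so the roots keep their order.
  have h2 : ∀ᶠ η in 𝓝[>] (0 : ℝ), ∀ k l, k < l → η < (r l - r k) / 2 :=
    eventually_all.mpr fun k => eventually_all.mpr fun l => by
      by_cases hkl : k < l
      · have : 0 < (r l - r k) / 2 := by linarith [hmono hkl]
        filter_upwards [nhdsWithin_le_nhds (eventually_lt_nhds this)] with η hη _ using hη
      · exact Eventually.of_forall fun η h => absurd h hkl
  have h3 : ∀ᶠ η in 𝓝[>] (0 : ℝ), η < ε := nhdsWithin_le_nhds (eventually_lt_nhds hε)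
  obtain ⟨η, hη1, hη2, hη3, hη4⟩ := (h1.and (h2.and (h3.and self_mem_nhdsWithin))).exists
  filter_upwards [eventually_all.mpr hη1, eventually_roots_near F (fun y => (hr y).mp) hM hη4]
    with x hx hx'
  choose z hz hzu using hx
  refine ⟨z, fun k l hkl => ?_, fun k => (hz k).1.trans hη3, fun y => ⟨fun hy => ?_, ?_⟩⟩
  · have e1 := abs_lt.mp (hz k).1
    have e2 := abs_lt.mp (hz l).1
    have := hη2 k l hkl
    linarith [e1.2, e2.1]
  · obtain ⟨k, hk⟩ := hx' y hy
    exact ⟨k, (hzu k y ⟨hk, hy⟩).symm⟩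
  · rintro ⟨k, rfl⟩
    exact (hz k).2

/-- Over an interval with simple, locally bounded roots, the curve `F = 0` is a disjoint union of
graphs of differentiable functions. -/
theorem exists_branches (F : MvPolynomial (Fin 2) ℝ) {I : Set ℝ} (hI : IsOpen I)
    (hI' : I.OrdConnected) {d : ℕ} (hd : ∀ x ∈ I, {y | eval ![x, y] F = 0}.encard ≤ d)
    (hFy : ∀ x ∈ I, ∀ y, eval ![x, y] F = 0 → eval ![x, y] (pderiv 1 F) ≠ 0)
    (hM : ∀ a ∈ I, ∃ M, ∀ᶠ x in 𝓝 a, ∀ y, eval ![x, y] F = 0 → |y| ≤ M) :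
    ∃ (n : ℕ) (φ : Fin n → ℝ → ℝ), n ≤ d ∧ (∀ x ∈ I, StrictMono fun k => φ k x) ∧
      (∀ x ∈ I, ∀ y, eval ![x, y] F = 0 ↔ ∃ k, φ k x = y) ∧
      ∀ k, ∀ x ∈ I, HasDerivAt (φ k)
        (-eval ![x, φ k x] (pderiv 0 F) / eval ![x, φ k x] (pderiv 1 F)) x := by
  have hfin : ∀ x ∈ I, {y | eval ![x, y] F = 0}.Finite := fun x hx =>
    Set.finite_of_encard_le_coe (hd x hx)
  have henum : ∀ x ∈ I, ∃ r : Fin {y | eval ![x, y] F = 0}.ncard → ℝ, StrictMono r ∧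
      ∀ y, eval ![x, y] F = 0 ↔ ∃ k, r k = y := by
    intro x hx
    refine ⟨(hfin x hx).toFinset.orderEmbOfFin (Set.ncard_eq_toFinset_card _ (hfin x hx)).symm,
      OrderEmbedding.strictMono _, fun y => ?_⟩
    rw [← Set.mem_range, Finset.range_orderEmbOfFin]
    simp
  have hcard : ∀ (m : ℕ) (z : Fin m → ℝ) (x : ℝ), StrictMono z →
      (∀ y, eval ![x, y] F = 0 ↔ ∃ k, z k = y) → {y | eval ![x, y] F = 0}.ncard = m := by
    intro m z x hz h
    have : {y | eval ![x, y] F = 0} = Set.range z := by ext y; exact h y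
    rw [this, ← Set.image_univ, Set.ncard_image_of_injective _ hz.injective]
    simp
  -- The number of roots is locally constant, and `I` is connected.
  have hconst : ∀ a ∈ I, ∀ b ∈ I, {y | eval ![a, y] F = 0}.ncard =
      {y | eval ![b, y] F = 0}.ncard := by
    intro a ha b hb
    refine hI'.isPreconnected.constant (f := fun x => {y | eval ![x, y] F = 0}.ncard)
      (fun c hc => ?_) ha hb
    refine ContinuousAt.continuousWithinAt ?_
    obtain ⟨r, hr, hr'⟩ := henum c hc
    obtain ⟨M, hM⟩ := hM c hc
    refine (continuousAt_const (y := {y | eval ![c, y] F = 0}.ncard)).congr ?_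
    filter_upwards [eventually_roots_enumeration F hr hr' (hFy c hc) hM one_pos]
      with x ⟨z, hz, _, hz'⟩
    exact (hcard _ z x hz hz').symm
  rcases I.eq_empty_or_nonempty with rfl | ⟨x₀, hx₀⟩
  · exact ⟨0, fun k => k.elim0, Nat.zero_le _, by simp, by simp, by simp⟩
  set n := {y | eval ![x₀, y] F = 0}.ncard with hn
  have henum' : ∀ x, ∃ r : Fin n → ℝ, x ∈ I → StrictMono r ∧
      ∀ y, eval ![x, y] F = 0 ↔ ∃ k, r k = y := by
    intro x
    by_cases hx : x ∈ I
    · have := henum x hx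
      rw [hconst x hx x₀ hx₀] at this
      obtain ⟨r, hr⟩ := this
      exact ⟨r, fun _ => hr⟩
    · exact ⟨0, fun h => absurd h hx⟩
  choose r hr using henum'
  refine ⟨n, fun k x => r x k, ?_, fun x hx => (hr x hx).1, fun x hx => (hr x hx).2, ?_⟩
  · have := hd x₀ hx₀
    rw [← (hfin x₀ hx₀).cast_ncard_eq] at this
    exact_mod_cast this
  · intro k a ha
    refine hasDerivAt_of_continuousAt_of_eval_eq_zero F ?_ ?_
      (hFy a ha _ (((hr a ha).2 _).mpr ⟨k, rfl⟩))
    · rw [Metric.continuousAt_iff']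
      intro ε hε
      obtain ⟨M, hM⟩ := hM a ha
      filter_upwards [eventually_roots_enumeration F (hr a ha).1 (hr a ha).2 (hFy a ha) hM hε,
        hI.mem_nhds ha] with x ⟨z, hz, hz1, hz'⟩ hx
      -- Two increasing enumerations of the same roots coincide; this gives continuity of the `k`-th
      -- root.
      have : z = r x := by
        refine (hz.range_inj (hr x hx).1).mp ?_
        ext y
        exact (hz' y).symm.trans ((hr x hx).2 y)
      rw [Real.dist_eq, ← this]
      exact hz1 k
    · filter_upwards [hI.mem_nhds ha] with x hx
      exact ((hr x hx).2 _).mpr ⟨k, rfl⟩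

end LocalStructure

/-! ### Rolle's theorem as a count of zeros. -/

section Rolle

/-- Lets Rolle be applied to finite sets of zeros, so that finiteness comes out as a conclusion. -/
theorem encard_le_of_forall_finset_card_le {α : Type*} {s : Set α} {n : ℕ}
    (h : ∀ t : Finset α, ↑t ⊆ s → t.card ≤ n) : s.encard ≤ n := by
  by_contra! hs
  obtain ⟨t, hts, htn⟩ := Set.exists_subset_encard_eq (Order.add_one_le_of_lt hs)
  have ht : t.Finite := Set.finite_of_encard_eq_coe (k := n + 1) (by rw [htn]; rfl)
  have h1 := h ht.toFinset (by simpa using hts)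
  rw [ht.encard_eq_coe_toFinset_card] at htn
  have : ht.toFinset.card = n + 1 := by exact_mod_cast htn
  omega

/-- Rolle's theorem for the quotient `u / v`, as a count of zeros. -/
theorem encard_zeros_le_of_rolle {I : Set ℝ} (hI : I.OrdConnected) {u v u' v' w : ℝ → ℝ}
    (hu : ∀ x ∈ I, HasDerivAt u (u' x) x) (hv : ∀ x ∈ I, HasDerivAt v (v' x) x)
    (hw : ∀ x ∈ I, u' x * v x - u x * v' x = 0 → w x = 0) :
    {x ∈ I | u x = 0}.encard ≤
      2 * {x ∈ I | v x = 0}.encard + {x ∈ I | w x = 0}.encard + 1 := by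
  classical
  by_cases hfv : {x ∈ I | v x = 0}.Finite
  swap
  · rw [show {x ∈ I | v x = 0}.encard = ⊤ from Set.Infinite.encard_eq hfv]
    simp
  by_cases hfw : {x ∈ I | w x = 0}.Finite
  swap
  · rw [show {x ∈ I | w x = 0}.encard = ⊤ from Set.Infinite.encard_eq hfw]
    simp
  -- Between two zeros of `u` that are not zeros of `v` lies a zero of `v` or of the derivative of
  -- `u / v`, hence of `w`. Common zeros of `u` and `v` are added afterwards, whence the factor 2.
  have h1 : ({x ∈ I | u x = 0} \ {x ∈ I | v x = 0}).encard ≤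
      ((hfv.toFinset ∪ hfw.toFinset).card + 1 : ℕ) := by
    refine encard_le_of_forall_finset_card_le fun s hs => ?_
    refine Finset.card_le_of_interleaved fun x hx y hy hxy _ => ?_
    obtain ⟨⟨hxI, hx0⟩, -⟩ := hs hx
    obtain ⟨⟨hyI, hy0⟩, hyv⟩ := hs hy
    have hxv := (hs hx).2
    have hsub : Set.Icc x y ⊆ I := hI.out hxI hyI
    by_cases hz : ∃ z ∈ Set.Ioo x y, v z = 0
    · obtain ⟨z, hz, hz0⟩ := hz
      exact ⟨z, Finset.mem_union_left _ (hfv.mem_toFinset.mpr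
        ⟨hsub (Set.Ioo_subset_Icc_self hz), hz0⟩), hz.1, hz.2⟩
    · push Not at hz
      have hne : ∀ z ∈ Set.Icc x y, v z ≠ 0 := by
        intro z hzI hz0
        rcases hzI.1.eq_or_lt with rfl | h1
        · exact hxv ⟨hxI, hz0⟩
        rcases hzI.2.eq_or_lt with rfl | h2
        · exact hyv ⟨hyI, hz0⟩
        · exact hz z ⟨h1, h2⟩ hz0
      have hder : ∀ z ∈ Set.Icc x y, HasDerivAt (fun z => u z / v z)
          ((u' z * v z - u z * v' z) / v z ^ 2) z := fun z hz =>
        (hu z (hsub hz)).div (hv z (hsub hz)) (hne z hz)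
      obtain ⟨z, hz, hz0⟩ := exists_hasDerivAt_eq_zero hxy
        (fun z hz => (hder z hz).continuousAt.continuousWithinAt) (by simp [hx0, hy0])
        fun z hz => hder z (Set.Ioo_subset_Icc_self hz)
      have hzI := Set.Ioo_subset_Icc_self hz
      rw [div_eq_zero_iff, or_iff_left (pow_ne_zero 2 (hne z hzI))] at hz0
      exact ⟨z, Finset.mem_union_right _ (hfw.mem_toFinset.mpr
        ⟨hsub hzI, hw z (hsub hzI) hz0⟩), hz.1, hz.2⟩
  have h2 : {x ∈ I | u x = 0}.encard ≤
      ({x ∈ I | u x = 0} \ {x ∈ I | v x = 0}).encard + {x ∈ I | v x = 0}.encard :=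
    (Set.encard_le_encard (by rw [Set.sdiff_union_self]; exact Set.subset_union_left)).trans
      (Set.encard_union_le _ _)
  have h3 := Finset.card_union_le hfv.toFinset hfw.toFinset
  rw [hfv.encard_eq_coe_toFinset_card, hfw.encard_eq_coe_toFinset_card]
  rw [hfv.encard_eq_coe_toFinset_card] at h2
  refine h2.trans ((add_le_add_left h1 _).trans ?_)
  norm_cast
  omega

end Rolle

/-! ### Counting zeros on the branches of a curve. -/

section Branches

/-- A decomposition of the curve `F = 0` into at most `b` disjoint graphs of differentiable
functions over open intervals, avoiding the coordinate axes and the critical points, and at most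
`e` exceptional points. -/
structure CurveBranches (F : MvPolynomial (Fin 2) ℝ) (b e : ℕ) where
  ι : Type
  fintype : Fintype ι
  card_le : Fintype.card ι ≤ b
  interval : ι → Set ℝ
  isOpen : ∀ i, IsOpen (interval i)
  ordConnected : ∀ i, (interval i).OrdConnected
  branch : ι → ℝ → ℝ
  eval_eq_zero : ∀ i, ∀ x ∈ interval i, eval ![x, branch i x] F = 0
  ne_zero : ∀ i, ∀ x ∈ interval i,
    x ≠ 0 ∧ branch i x ≠ 0 ∧ eval ![x, branch i x] (pderiv 1 F) ≠ 0
  hasDerivAt : ∀ i, ∀ x ∈ interval i, HasDerivAt (branch i)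
    (-eval ![x, branch i x] (pderiv 0 F) / eval ![x, branch i x] (pderiv 1 F)) x
  injective : ∀ i j, ∀ x ∈ interval i, x ∈ interval j → branch i x = branch j x → i = j
  exceptional : Set (Fin 2 → ℝ)
  exceptional_subset : ∀ p ∈ exceptional, eval p F = 0
  encard_exceptional_le : exceptional.encard ≤ e
  cover : ∀ p, eval p F = 0 → p ∈ exceptional ∨ ∃ i, p 0 ∈ interval i ∧ branch i (p 0) = p 1

namespace CurveBranches

variable {F : MvPolynomial (Fin 2) ℝ} {b e : ℕ} (B : CurveBranches F b e)

attribute [instance] CurveBranches.fintype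

/-- The zeros of `H` on the `i`-th branch. -/
def zeros (i : B.ι) (H : MvPolynomial (Fin 2) ℝ) : Set ℝ :=
  {x ∈ B.interval i | eval ![x, B.branch i x] H = 0}

/-- The number of zeros of `H` on all branches. -/
noncomputable def count (H : MvPolynomial (Fin 2) ℝ) : ℕ∞ := ∑ i, (B.zeros i H).encard

/-- Distinct branches are disjoint, so no point of the curve is counted twice. -/
theorem count_le (H : MvPolynomial (Fin 2) ℝ) : B.count H ≤ (realSolutions F H).encard := by
  let g : B.ι → ℝ → (Fin 2 → ℝ) := fun i x => ![x, B.branch i x]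
  have hg : ∀ i, Function.Injective (g i) := fun i x y h => congrFun h 0
  have h1 : B.count H = (⋃ i, g i '' B.zeros i H).encard := by
    rw [Set.encard_iUnion_of_finite, finsum_eq_sum_of_fintype]
    · exact Finset.sum_congr rfl fun i _ => ((hg i).encard_image _).symm
    · intro i j hij
      rw [Function.onFun, Set.disjoint_left]
      rintro _ ⟨x, hx, rfl⟩ ⟨y, hy, hxy⟩
      have e0 : y = x := congrFun hxy 0
      have e1 : B.branch j y = B.branch i x := congrFun hxy 1
      subst e0
      exact hij (B.injective i j y hx.1 hy.1 e1.symm)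
  rw [h1]
  refine Set.encard_le_encard (Set.iUnion_subset fun i => ?_)
  rintro _ ⟨x, hx, rfl⟩
  exact ⟨B.eval_eq_zero i x hx.1, hx.2⟩

theorem encard_realSolutions_le (H : MvPolynomial (Fin 2) ℝ) :
    (realSolutions F H).encard ≤ e + B.count H := by
  have h1 : realSolutions F H ⊆
      B.exceptional ∪ ⋃ i, (fun x => ![x, B.branch i x]) '' B.zeros i H := by
    rintro p ⟨hpF, hpH⟩
    refine (B.cover p hpF).imp id fun ⟨i, hi, hi'⟩ => Set.mem_iUnion.mpr ⟨i, p 0, ?_⟩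
    have : ![p 0, B.branch i (p 0)] = p := by
      rw [hi']; ext k; fin_cases k <;> rfl
    exact ⟨⟨hi, by rw [this]; exact hpH⟩, this⟩
  refine (Set.encard_le_encard h1).trans ((Set.encard_union_le _ _).trans
    (add_le_add B.encard_exceptional_le ?_))
  refine (Set.encard_iUnion_le_of_fintype _).trans (Finset.sum_le_sum fun i _ => ?_)
  exact Set.encard_image_le _ _

/-- Along a branch $y'=-F_X/F_Y$, so $d/dx$ is $D$ divided by $xyF_Y$, which has no zeros there:
zeros of derivatives can be read off from $D$. -/
theorem hasDerivAt_eval (i : B.ι) {x : ℝ} (hx : x ∈ B.interval i) (P : MvPolynomial (Fin 2) ℝ) :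
    HasDerivAt (fun s => eval ![s, B.branch i s] P)
      (eval ![x, B.branch i x] (tangentDerivation F P) /
        (x * B.branch i x * eval ![x, B.branch i x] (pderiv 1 F))) x := by
  convert! hasDerivAt_eval_graph P (B.hasDerivAt i x hx) using 1
  obtain ⟨h1, h2, h3⟩ := B.ne_zero i x hx
  rw [tangentDerivation_apply]
  simp
  field_simp
  ring

/-- A generalized Rolle theorem on the branches of the curve. -/
theorem count_le_of_tangentDerivation {U V W : MvPolynomial (Fin 2) ℝ}
    (hW : tangentDerivation F U * V - U * tangentDerivation F V = W) :
    B.count U ≤ 2 * B.count V + B.count W + b := by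
  have h : ∀ i, (B.zeros i U).encard ≤ 2 * (B.zeros i V).encard + (B.zeros i W).encard + 1 := by
    intro i
    refine encard_zeros_le_of_rolle (B.ordConnected i)
      (fun x hx => B.hasDerivAt_eval i hx U) (fun x hx => B.hasDerivAt_eval i hx V) ?_
    intro x hx h0
    obtain ⟨h1, h2, h3⟩ := B.ne_zero i x hx
    rw [← hW]
    simp only [map_sub, map_mul]
    field_simp at h0
    linarith
  refine (Finset.sum_le_sum fun i _ => h i).trans ?_
  rw [Finset.sum_add_distrib, Finset.sum_add_distrib, ← Finset.mul_sum]
  refine add_le_add le_rfl ?_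
  simpa using B.card_le

theorem count_mul_le (P Q : MvPolynomial (Fin 2) ℝ) :
    B.count (P * Q) ≤ B.count P + B.count Q := by
  unfold count
  rw [← Finset.sum_add_distrib]
  refine Finset.sum_le_sum fun i _ => ?_
  refine (Set.encard_le_encard ?_).trans (Set.encard_union_le _ _)
  rintro x ⟨hx, h0⟩
  rw [map_mul, mul_eq_zero] at h0
  exact h0.imp (fun h => ⟨hx, h⟩) fun h => ⟨hx, h⟩

theorem count_smul (P : MvPolynomial (Fin 2) ℝ) {c : ℝ} (hc : c ≠ 0) :
    B.count (c • P) = B.count P := by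
  simp [count, zeros, hc]

theorem count_snocWronskian_le (f : ℕ → MvPolynomial (Fin 2) ℝ) (g : MvPolynomial (Fin 2) ℝ)
    (k : ℕ) (hk : derivationWronskian (tangentDerivation F) f k ≠ 0) :
    B.count (snocWronskian (tangentDerivation F) f k g) ≤
      2 * B.count (derivationWronskian (tangentDerivation F) f (k + 1)) +
      (B.count (derivationWronskian (tangentDerivation F) f k) +
        B.count (snocWronskian (tangentDerivation F) f (k + 1) g)) + b :=
  (B.count_le_of_tangentDerivation (snocWronskian_identity _ f k g hk)).trans
    (add_le_add (add_le_add le_rfl (B.count_mul_le _ _)) le_rfl)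

/-- A linear combination of functions has few zeros if their Wronskians do. -/
theorem count_linearCombination_le (f : ℕ → MvPolynomial (Fin 2) ℝ) (c : ℕ → ℝ) (s w : ℕ)
    (hc : c s ≠ 0) (h0 : ∀ k ≤ s, derivationWronskian (tangentDerivation F) f k ≠ 0)
    (hw : ∀ k ≤ s + 1, B.count (derivationWronskian (tangentDerivation F) f k) ≤ w) :
    B.count (∑ i ∈ Finset.range (s + 1), c i • f i) ≤ (s * (3 * w + b) + w : ℕ) := by
  set g := ∑ i ∈ Finset.range (s + 1), c i • f i with hg
  -- Each Rolle step costs $2w+w+b$ and appends one more function to the Wronskian; `k = 0` is `g`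
  -- itself.
  have h : ∀ k ≤ s, B.count g ≤
      (k * (3 * w + b) : ℕ) + B.count (snocWronskian (tangentDerivation F) f k g) := by
    intro k
    induction k with
    | zero => intro _; simp [snocWronskian_zero]
    | succ k ih =>
      intro hk
      refine (ih (by omega)).trans ?_
      have h1 := B.count_snocWronskian_le f g k (h0 k (by omega))
      have h2 := hw (k + 1) (by omega)
      have h3 := hw k (by omega)
      have h4 : B.count (snocWronskian (tangentDerivation F) f k g) ≤ 2 * (w : ℕ∞) +
          ((w : ℕ∞) + B.count (snocWronskian (tangentDerivation F) f (k + 1) g)) + b :=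
        h1.trans (by gcongr)
      refine (add_le_add le_rfl h4).trans_eq ?_
      push_cast
      ring
  refine (h s le_rfl).trans ?_
  rw [hg, snocWronskian_sum, count_smul _ _ hc]
  push_cast
  exact add_le_add le_rfl (hw (s + 1) le_rfl)

theorem dvd_of_infinite_zeros_on_branch (hF : Irreducible F) (i : B.ι) {J : Set ℝ} (hJ : J.Infinite)
    (hJI : J ⊆ B.interval i) {H : MvPolynomial (Fin 2) ℝ}
    (hH : ∀ x ∈ J, eval ![x, B.branch i x] H = 0) : F ∣ H := by
  refine dvd_of_infinite_zeros hF ?_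
  refine (hJ.image (f := fun x => ![x, B.branch i x]) fun x _ y _ h => congrFun h 0).mono ?_
  rintro _ ⟨x, hx, rfl⟩
  exact ⟨B.eval_eq_zero i x (hJI hx), hH x hx⟩

/-- If the Wronskian of `f 0, …, f (k - 1), g` vanishes on an irreducible curve, then `g` is a
linear combination of `f 0, …, f (k - 1)` on it. -/
theorem exists_linearCombination_of_dvd_snocWronskian (hF : Irreducible F) (i : B.ι)
    (hi : (B.interval i).Nonempty) (f : ℕ → MvPolynomial (Fin 2) ℝ) (k : ℕ)
    (hf : ∀ j ≤ k, ¬ F ∣ derivationWronskian (tangentDerivation F) f j)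
    (g : MvPolynomial (Fin 2) ℝ) (hg : F ∣ snocWronskian (tangentDerivation F) f k g) :
    ∃ c : ℕ → ℝ, F ∣ g - ∑ j ∈ Finset.range k, c j • f j := by
  induction k generalizing g with
  | zero => exact ⟨0, by simpa [snocWronskian_zero] using hg⟩
  | succ k ih =>
    set D := tangentDerivation F with hD
    set V := derivationWronskian D f (k + 1) with hV
    set U := snocWronskian D f k g with hU
    have hfin : (B.zeros i V).Finite := by
      by_contra hinf
      exact hf (k + 1) le_rfl (B.dvd_of_infinite_zeros_on_branch hF i hinf (fun x hx => hx.1)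
        fun x hx => hx.2)
    have hIinf : (B.interval i).Infinite := by
      obtain ⟨x, hx⟩ := hi
      exact infinite_of_mem_nhds x ((B.isOpen i).mem_nhds hx)
    obtain ⟨x₀, hx₀, hx₀V⟩ := (hIinf.sdiff hfin).nonempty
    have hV0 : eval ![x₀, B.branch i x₀] V ≠ 0 := fun h => hx₀V ⟨hx₀, h⟩
    obtain ⟨δ, hδ, hball⟩ := Metric.eventually_nhds_iff_ball.mp
      (((B.isOpen i).eventually_mem hx₀).and
        ((B.hasDerivAt_eval i hx₀ V).continuousAt.eventually_ne hV0))
    -- The numerator of the derivative of $U/V$ is a multiple of $F$ by `snocWronskian_identity`, so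
    -- the quotient is locally constant. Its value is the coefficient of `f k`, and what remains
    -- involves one function less.
    let h : ℝ → ℝ := fun x => eval ![x, B.branch i x] U / eval ![x, B.branch i x] V
    have hder : ∀ x ∈ Metric.ball x₀ δ, HasDerivAt h 0 x := by
      intro x hx
      obtain ⟨hxI, hxV⟩ := hball x hx
      convert! (B.hasDerivAt_eval i hxI U).div (B.hasDerivAt_eval i hxI V) hxV using 1
      have hid := congrArg (eval ![x, B.branch i x]) (snocWronskian_identity D f k g
        (fun h0 => hf k (by omega) (h0 ▸ dvd_zero F)))
      obtain ⟨q, hq⟩ := hg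
      rw [hq] at hid
      simp only [map_sub, map_mul, B.eval_eq_zero i x hxI, zero_mul, mul_zero] at hid
      symm
      rw [div_eq_zero_iff]
      left
      rw [div_mul_eq_mul_div, mul_div_assoc', ← sub_div, hid, zero_div]
    have hconst : ∀ x ∈ Metric.ball x₀ δ, h x = h x₀ := fun x hx =>
      Metric.isOpen_ball.is_const_of_deriv_eq_zero (convex_ball x₀ δ).isPreconnected
        (fun y hy => (hder y hy).differentiableAt.differentiableWithinAt)
        (fun y hy => (hder y hy).deriv) hx (Metric.mem_ball_self hδ)
    have hdvd : F ∣ snocWronskian D f k (g - h x₀ • f k) := by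
      refine B.dvd_of_infinite_zeros_on_branch hF i (infinite_of_mem_nhds x₀ (Metric.ball_mem_nhds x₀ hδ))
        (fun x hx => (hball x hx).1) fun x hx => ?_
      rw [snocWronskian_sub_smul, map_sub, smul_eval, ← hconst x hx]
      simp only [h]
      rw [div_mul_cancel₀ _ (hball x hx).2, sub_self]
    obtain ⟨c, hc⟩ := ih (fun j hj => hf j (by omega)) _ hdvd
    refine ⟨Function.update c k (h x₀), ?_⟩
    rw [Finset.sum_range_succ, Function.update_self, Finset.sum_congr rfl fun j hj => by
      rw [Function.update_of_ne (Finset.mem_range.mp hj).ne]]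
    convert! hc using 1
    ring

/-- Wronskians of functions independent on an irreducible curve do not vanish on it. -/
theorem not_dvd_derivationWronskian (hF : Irreducible F) (i : B.ι)
    (hi : (B.interval i).Nonempty) (f : ℕ → MvPolynomial (Fin 2) ℝ) (s : ℕ)
    (hind : ∀ c : ℕ → ℝ, F ∣ ∑ j ∈ Finset.range s, c j • f j → ∀ j < s, c j = 0) :
    ∀ k ≤ s, ¬ F ∣ derivationWronskian (tangentDerivation F) f k := by
  intro k
  induction k using Nat.strong_induction_on with
  | _ k ih =>
    intro hk hdvd
    rcases k with _ | k
    · rw [derivationWronskian_zero] at hdvd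
      exact hF.not_isUnit (isUnit_of_dvd_one hdvd)
    · rw [← snocWronskian_self] at hdvd
      obtain ⟨c, hc⟩ := B.exists_linearCombination_of_dvd_snocWronskian hF i hi f k
        (fun j hj => ih j (by omega) (by omega)) (f k) hdvd
      let c' : ℕ → ℝ := fun j => if j < k then -c j else if j = k then 1 else 0
      have h1 : ∑ j ∈ Finset.range s, c' j • f j = f k - ∑ j ∈ Finset.range k, c j • f j := by
        rw [← Finset.sum_subset (Finset.range_subset_range.mpr hk)]
        · rw [Finset.sum_range_succ, Finset.sum_congr rfl (g := fun j => -(c j • f j))]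
          · simp [c', Finset.sum_neg_distrib, sub_eq_add_neg, add_comm]
          · intro j hj
            simp [c', Finset.mem_range.mp hj]
        · intro j _ hj
          rw [Finset.mem_range, not_lt] at hj
          simp [c', show ¬ j < k by omega, show j ≠ k by omega]
      have := hind c' (h1 ▸ hc) k hk
      simp [c'] at this

/-- Branches avoid the axes, so the monomial factor has no zeros and Bezout applies to the other
factor alone. -/
theorem count_wronskian_monomial_le (hF : Irreducible F) (m : ℕ → Fin 2 →₀ ℕ) (k : ℕ)
    (hk : ¬ F ∣ derivationWronskian (tangentDerivation F) (fun i => monomial (m i) 1) k) :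
    B.count (derivationWronskian (tangentDerivation F) (fun i => monomial (m i) 1) k) ≤
      (F.totalDegree * (k * k * F.totalDegree) : ℕ) := by
  obtain ⟨T, hT, hdeg⟩ := exists_wronskian_monomial_eq F m k
  rw [hT] at hk ⊢
  have hT' : ¬ F ∣ T := fun h => hk (h.mul_left _)
  have h1 : B.count ((∏ i : Fin k, monomial (m i) 1) * T) ≤ B.count T := by
    refine Finset.sum_le_sum fun i _ => Set.encard_le_encard ?_
    rintro x ⟨hx, h0⟩
    obtain ⟨hx1, hx2, -⟩ := B.ne_zero i x hx
    refine ⟨hx, ?_⟩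
    rw [map_mul] at h0
    refine (mul_eq_zero.mp h0).resolve_left ?_
    rw [eval_prod]
    refine Finset.prod_ne_zero_iff.mpr fun j _ => ?_
    rw [eval_monomial, Finsupp.prod_fintype _ _ (by simp)]
    simp [Fin.prod_univ_two, hx1, hx2]
  refine h1.trans ((B.count_le T).trans ((_root_.encard_realSolutions_le hF hT').trans ?_))
  exact_mod_cast Nat.mul_le_mul_left _ hdeg

end CurveBranches

end Branches

/-! ### The intervals cut out by a finite set of reals. -/

section Cells

/-- The set of points outside `E` with exactly `k` elements of `E` to their left. -/
def cell (E : Finset ℝ) (k : ℕ) : Set ℝ := {x | x ∉ E ∧ (E.filter (· < x)).card = k}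

theorem isOpen_cell (E : Finset ℝ) (k : ℕ) : IsOpen (cell E k) := by
  rw [isOpen_iff_eventually]
  rintro x ⟨hxE, hx⟩
  have h : ∀ᶠ y in nhds x, ∀ e ∈ E, y ≠ e ∧ (e < y ↔ e < x) := by
    rw [Filter.eventually_all_finset]
    intro e he
    rcases lt_trichotomy e x with h | h | h
    · filter_upwards [eventually_gt_nhds h] with y hy using ⟨hy.ne', iff_of_true hy h⟩
    · exact absurd (h ▸ he) hxE
    · filter_upwards [eventually_lt_nhds h] with y hy using ⟨hy.ne, iff_of_false hy.not_gt h.not_gt⟩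
  filter_upwards [h] with y hy
  refine ⟨fun hyE => (hy y hyE).1 rfl, ?_⟩
  rw [← hx]
  congr 1
  exact Finset.filter_congr fun e he => (hy e he).2

theorem ordConnected_cell (E : Finset ℝ) (k : ℕ) : (cell E k).OrdConnected := by
  refine ⟨?_⟩
  rintro x ⟨hxE, hx⟩ y ⟨hyE, hy⟩ z ⟨hxz, hzy⟩
  have h1 : E.filter (· < x) ⊆ E.filter (· < z) :=
    Finset.monotone_filter_right _ fun e _ h => lt_of_lt_of_le h hxz
  have h2 : E.filter (· < z) ⊆ E.filter (· < y) :=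
    Finset.monotone_filter_right _ fun e _ h => lt_of_lt_of_le h hzy
  have c1 := Finset.card_le_card h1
  have c2 := Finset.card_le_card h2
  refine ⟨fun hzE => ?_, by omega⟩
  have h3 := Finset.eq_of_subset_of_card_le (h1.trans h2) (by omega)
  have hzy' : z < y := lt_of_le_of_ne hzy fun h => hyE (h ▸ hzE)
  have : z ∈ E.filter (· < x) := h3 ▸ Finset.mem_filter.mpr ⟨hzE, hzy'⟩
  exact absurd (Finset.mem_filter.mp this).2 (not_lt.mpr hxz)

theorem exists_mem_cell {E : Finset ℝ} {x : ℝ} (hx : x ∉ E) :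
    ∃ k : Fin (E.card + 1), x ∈ cell E k :=
  ⟨⟨(E.filter (· < x)).card, Nat.lt_succ_of_le (Finset.card_filter_le _ _)⟩, hx, rfl⟩

end Cells

/-! ### Decomposition of an irreducible curve into branches. -/

section Construction

variable {F : MvPolynomial (Fin 2) ℝ}

theorem vec_eta (p : Fin 2 → ℝ) : ![p 0, p 1] = p := by
  ext i; fin_cases i <;> rfl

/-- Bezout against the line $X=a$. -/
theorem encard_fiber_le (hF : Irreducible F) {a : ℝ} (ha : ¬ F ∣ X 0 - C a) :
    {y | eval ![a, y] F = 0}.encard ≤ F.totalDegree := by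
  have h := encard_realSolutions_le hF ha
  have hdeg : (X 0 - C a : MvPolynomial (Fin 2) ℝ).totalDegree ≤ 1 :=
    (totalDegree_sub_C_le _ _).trans (totalDegree_X (R := ℝ) 0).le
  have hinj : Function.Injective fun y : ℝ => ![a, y] := fun y z h => congrFun h 1
  rw [← hinj.encard_image]
  refine (Set.encard_le_encard ?_).trans (h.trans ?_)
  · rintro _ ⟨y, hy, rfl⟩
    exact ⟨hy, by simp⟩
  · exact_mod_cast (Nat.mul_le_mul_left _ hdeg).trans (mul_one _).le

theorem encard_vertical_le (hF : Irreducible F) {a : ℝ} (ha : ¬ F ∣ X 0 - C a) :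
    {p | p 0 = a ∧ eval p F = 0}.encard ≤ F.totalDegree := by
  refine le_trans ?_ (encard_fiber_le hF ha)
  refine (Set.encard_le_encard ?_).trans (Set.encard_image_le (fun y : ℝ => ![a, y]) _)
  rintro p ⟨rfl, hp⟩
  exact ⟨p 1, by simpa only [Set.mem_ofPred_eq, vec_eta] using hp, vec_eta p⟩

/-- The curve `F = 0` has a finite set of critical values of the first coordinate. -/
theorem exists_critical_values (hF : Irreducible F) (hY : ¬ F ∣ X 1) (hFy : ¬ F ∣ pderiv 1 F) :
    ∃ E : Finset ℝ, E.card ≤ F.totalDegree * F.totalDegree + 2 * F.totalDegree + 1 ∧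
      ∀ a ∉ E, a ≠ 0 ∧ (∀ y, eval ![a, y] F = 0 → y ≠ 0 ∧ eval ![a, y] (pderiv 1 F) ≠ 0) ∧
        ∃ M, ∀ᶠ x in nhds a, ∀ y, eval ![x, y] F = 0 → |y| ≤ M := by
  classical
  obtain ⟨q, hq, hqdeg, hbdd⟩ := exists_fibers_locally_bounded F hF.ne_zero
  have hdeg : (pderiv 1 F).totalDegree ≤ F.totalDegree := by
    have := totalDegree_pderiv_add_one_le 1 F (fun h => hFy (h ▸ dvd_zero F))
    omega
  -- The axis $X=0$, at most $d$ zeros of the leading coefficient, at most $d$ crossings of $Y=0$,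
  -- and at most $d^2$ points with $F_Y=0$.
  let S : Set ℝ := {0} ∪ ↑q.roots.toFinset ∪ (fun p => p 0) '' realSolutions F (X 1) ∪
    (fun p => p 0) '' realSolutions F (pderiv 1 F)
  have hS : S.encard ≤ (F.totalDegree * F.totalDegree + 2 * F.totalDegree + 1 : ℕ) := by
    have h1 : (q.roots.toFinset : Set ℝ).encard ≤ (F.totalDegree : ℕ) := by
      rw [Set.encard_coe_eq_coe_finsetCard]
      exact_mod_cast (Multiset.toFinset_card_le _).trans ((q.card_roots').trans hqdeg)
    have h2 : ((fun p => p 0) '' realSolutions F (X 1)).encard ≤ (F.totalDegree : ℕ) := by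
      refine (Set.encard_image_le _ _).trans ((encard_realSolutions_le hF hY).trans ?_)
      rw [totalDegree_X, mul_one]
    have h3 : ((fun p => p 0) '' realSolutions F (pderiv 1 F)).encard ≤
        (F.totalDegree * F.totalDegree : ℕ) := by
      refine (Set.encard_image_le _ _).trans ((encard_realSolutions_le hF hFy).trans ?_)
      exact_mod_cast Nat.mul_le_mul_left _ hdeg
    refine (Set.encard_union_le _ _).trans ((add_le_add ((Set.encard_union_le _ _).trans
      (add_le_add ((Set.encard_union_le _ _).trans (add_le_add
        (Set.encard_singleton _).le h1)) h2)) h3).trans ?_)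
    norm_cast
    omega
  have hfin : S.Finite := Set.finite_of_encard_le_coe hS
  refine ⟨hfin.toFinset, ?_, fun a ha => ?_⟩
  · rw [hfin.encard_eq_coe_toFinset_card] at hS
    exact_mod_cast hS
  · rw [hfin.mem_toFinset] at ha
    simp only [S, Set.mem_union, not_or] at ha
    obtain ⟨⟨⟨h1, h2⟩, h3⟩, h4⟩ := ha
    refine ⟨h1, fun y hy => ⟨?_, fun h => h4 ⟨![a, y], ⟨hy, h⟩, rfl⟩⟩, hbdd a fun h => h2 ?_⟩
    · rintro rfl
      exact h3 ⟨![a, 0], ⟨hy, by simp⟩, rfl⟩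
    · rw [Finset.mem_coe, Multiset.mem_toFinset, Polynomial.mem_roots hq]
      exact h

/-- At most $N$ critical abscissas leave at most $N+1$ cells with at most $d$ branches each, and
carry at most $d$ exceptional points each. -/
theorem nonempty_curveBranches (hF : Irreducible F) (hX : ∀ a, ¬ F ∣ X 0 - C a)
    (hY : ¬ F ∣ X 1) (hFy : ¬ F ∣ pderiv 1 F) {N : ℕ}
    (hN : N = F.totalDegree * F.totalDegree + 2 * F.totalDegree + 1) :
    Nonempty (CurveBranches F ((N + 1) * F.totalDegree) (N * F.totalDegree)) := by
  classical
  obtain ⟨E, hEcard, hE⟩ := exists_critical_values hF hY hFy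
  rw [← hN] at hEcard
  have hbr : ∀ k : ℕ, _ := fun k => exists_branches F (isOpen_cell E k) (ordConnected_cell E k)
    (fun x _ => encard_fiber_le hF (hX x)) (fun x hx y hy => ((hE x hx.1).2.1 y hy).2)
    (fun a ha => (hE a ha.1).2.2)
  choose n φ hn hmono hroots hderiv using hbr
  refine ⟨{
    ι := Σ k : Fin (E.card + 1), Fin (n k)
    fintype := inferInstance
    card_le := ?_
    interval := fun i => cell E i.1
    isOpen := fun i => isOpen_cell E i.1
    ordConnected := fun i => ordConnected_cell E i.1
    branch := fun i => φ i.1 i.2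
    eval_eq_zero := fun i x hx => (hroots _ x hx _).mpr ⟨i.2, rfl⟩
    ne_zero := fun i x hx => ?_
    hasDerivAt := fun i x hx => hderiv _ i.2 x hx
    injective := ?_
    exceptional := ⋃ a ∈ E, {p | p 0 = a ∧ eval p F = 0}
    exceptional_subset := ?_
    encard_exceptional_le := ?_
    cover := fun p hp => ?_ }⟩
  · rw [Fintype.card_sigma]
    refine (Finset.sum_le_card_nsmul _ _ _ fun k _ => ?_).trans
      (Nat.mul_le_mul_right F.totalDegree (by simpa using hEcard))
    simpa using hn k
  · have h0 := (hroots _ x hx _).mpr ⟨i.2, rfl⟩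
    exact ⟨(hE x hx.1).1, (hE x hx.1).2.1 _ h0⟩
  · rintro ⟨k, i⟩ ⟨l, j⟩ x hx hx' h
    obtain rfl : k = l := Fin.ext (hx.2.symm.trans hx'.2)
    obtain rfl : i = j := (hmono k x hx).injective h
    rfl
  · intro p hp
    simp only [Set.mem_iUnion] at hp
    obtain ⟨a, _, hp⟩ := hp
    exact hp.2
  · refine (Finset.set_encard_biUnion_le E _).trans ((Finset.sum_le_sum fun a _ =>
      encard_vertical_le hF (hX a)).trans ?_)
    rw [Finset.sum_const, nsmul_eq_mul]
    exact_mod_cast Nat.mul_le_mul_right _ hEcard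
  · by_cases hpE : p 0 ∈ E
    · left
      simp only [Set.mem_iUnion]
      exact ⟨p 0, hpE, rfl, hp⟩
    · right
      obtain ⟨k, hk⟩ := exists_mem_cell hpE
      obtain ⟨j, hj⟩ := (hroots k (p 0) hk (p 1)).mp (by rwa [vec_eta])
      exact ⟨⟨k, j⟩, hk, hj⟩

end Construction

/-! ### Reduction to monomials independent modulo $F$. -/

section Independence

/-- Modulo `F`, a sparse polynomial is a combination of independent monomials with nonzero
coefficients. -/
theorem exists_independent_monomials (F G : MvPolynomial (Fin 2) ℝ) :
    ∃ (s : ℕ) (m : ℕ → Fin 2 →₀ ℕ) (c : ℕ → ℝ), s ≤ G.support.card ∧ (∀ i < s, c i ≠ 0) ∧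
      (∀ a : ℕ → ℝ, F ∣ ∑ j ∈ Finset.range s, a j • monomial (m j) (1 : ℝ) →
        ∀ j < s, a j = 0) ∧
      F ∣ G - ∑ j ∈ Finset.range s, c j • monomial (m j) (1 : ℝ) := by
  classical
  -- The least number of monomials representing $G$ modulo $F$: a zero coefficient, or a relation
  -- modulo $F$, would allow one fewer.
  let P : ℕ → Prop := fun s => ∃ (T : Finset (Fin 2 →₀ ℕ)) (c : (Fin 2 →₀ ℕ) → ℝ),
    T.card = s ∧ F ∣ G - ∑ j ∈ T, c j • monomial j (1 : ℝ)
  have hP : P G.support.card := by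
    refine ⟨G.support, G.coeff, rfl, ?_⟩
    have : G = ∑ j ∈ G.support, G.coeff j • monomial j (1 : ℝ) := by
      conv_lhs => rw [G.as_sum]
      simp [smul_monomial]
    rw [← this, sub_self]
    exact dvd_zero F
  have hex : ∃ s, P s := ⟨_, hP⟩
  obtain ⟨T, c, hT, hc⟩ := Nat.find_spec hex
  have hmin : ∀ (j : Fin 2 →₀ ℕ) (c' : (Fin 2 →₀ ℕ) → ℝ), j ∈ T → c' j = 0 →
      ¬ F ∣ G - ∑ j ∈ T, c' j • monomial j (1 : ℝ) := by
    intro j c' hj h0 hdvd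
    refine Nat.find_min hex (m := (T.erase j).card) ?_ ⟨T.erase j, c', rfl, ?_⟩
    · rw [← hT]
      exact Finset.card_erase_lt_of_mem hj
    · rwa [← Finset.add_sum_erase _ _ hj, h0, zero_smul, zero_add] at hdvd
  let e : Fin T.card ≃ T := T.equivFin.symm
  let m : ℕ → Fin 2 →₀ ℕ := fun i => if h : i < T.card then (e ⟨i, h⟩).1 else 0
  have hm : ∀ i : Fin T.card, m i = (e i).1 := fun i => by simp [m]
  have hsum : ∀ a : (Fin 2 →₀ ℕ) → ℝ,
      ∑ j ∈ Finset.range T.card, a (m j) • monomial (m j) (1 : ℝ) =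
        ∑ j ∈ T, a j • monomial j (1 : ℝ) := by
    intro a
    rw [Finset.sum_range, ← Finset.sum_coe_sort T, ← e.sum_comp]
    simp only [hm]
  refine ⟨T.card, m, fun i => c (m i), ?_, ?_, ?_, ?_⟩
  · rw [hT]
    exact Nat.find_le hP
  · intro i hi h0
    have hi' := hm ⟨i, hi⟩
    exact hmin (m i) c (by rw [show m i = _ from hi']; exact (e ⟨i, hi⟩).2) h0 hc
  · intro a ha j hj
    by_contra haj
    let a' : (Fin 2 →₀ ℕ) → ℝ := fun x => if h : x ∈ T then a (e.symm ⟨x, h⟩) else 0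
    have ha' : ∀ i < T.card, a' (m i) = a i := by
      intro i hi
      have h1 := hm ⟨i, hi⟩
      have h2 : m i ∈ T := by rw [show m i = _ from h1]; exact (e ⟨i, hi⟩).2
      have h3 : (⟨m i, h2⟩ : T) = e ⟨i, hi⟩ := Subtype.ext h1
      simp only [a', dif_pos h2, h3, Equiv.symm_apply_apply]
    rw [Finset.sum_congr rfl (fun i hi => by rw [← ha' i (Finset.mem_range.mp hi)]),
      hsum a'] at ha
    have hmT : m j ∈ T := by rw [show m j = _ from hm ⟨j, hj⟩]; exact (e ⟨j, hj⟩).2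
    have hne : a' (m j) ≠ 0 := by rw [ha' j hj]; exact haj
    -- The multiple of the relation is chosen to cancel the coefficient of `m j`.
    refine hmin (m j) (fun x => c x - c (m j) / a' (m j) * a' x) hmT ?_ ?_
    · field_simp
      ring
    · have : G - ∑ x ∈ T, (c x - c (m j) / a' (m j) * a' x) • monomial x (1 : ℝ) =
          (G - ∑ x ∈ T, c x • monomial x (1 : ℝ)) +
            C (c (m j) / a' (m j)) * ∑ x ∈ T, a' x • monomial x (1 : ℝ) := by
        simp only [sub_smul, Finset.sum_sub_distrib, mul_smul, ← Finset.smul_sum, ← smul_eq_C_mul]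
        abel
      rw [this]
      exact dvd_add hc (ha.mul_left _)
  · rw [hsum c]
    exact hc

end Independence

/-! ### Sparse polynomials on axis-parallel lines, by Descartes' rule. -/

section Lines

-- Deleting the leading term loses at most one sign variation.
open Polynomial in
theorem signVariations_le_card_support (P : ℝ[X]) : P.signVariations ≤ P.support.card := by
  induction h : P.support.card generalizing P with
  | zero =>
    rw [Finset.card_eq_zero, Polynomial.support_eq_empty] at h
    simp [h]
  | succ n ih =>
    exact (signVariations_le_eraseLead_succ P).trans
      (Nat.succ_le_succ (ih P.eraseLead (Polynomial.card_support_eraseLead' h)))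

open Polynomial in
theorem card_pos_roots_le (P : ℝ[X]) :
    (P.roots.toFinset.filter (0 < ·)).card ≤ P.support.card := by
  refine le_trans ?_ ((roots_countP_pos_le_signVariations (P := P)).trans
    (signVariations_le_card_support P))
  rw [Multiset.countP_eq_card_filter, ← Multiset.toFinset_filter]
  exact Multiset.toFinset_card_le _

open Polynomial in
/-- A nonzero real polynomial in one variable with few monomials has few real roots. -/
theorem card_roots_toFinset_le (P : ℝ[X]) :
    P.roots.toFinset.card ≤ 2 * P.support.card + 1 := by
  classical
  -- Negative roots of $P$ are positive roots of $P(-X)$; the root $0$ accounts for the extra 1.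
  set Q := P.comp (Polynomial.C (-1) * Polynomial.X) with hQ
  have hsupp : Q.support ⊆ P.support := by
    intro n hn
    rw [Polynomial.mem_support_iff, hQ, Polynomial.comp_C_mul_X_coeff] at hn
    exact Polynomial.mem_support_iff.mpr (left_ne_zero_of_mul hn)
  have hneg : (P.roots.toFinset.filter (· < 0)).card ≤ P.support.card := by
    refine le_trans ?_ ((card_pos_roots_le Q).trans (Finset.card_le_card hsupp))
    refine Finset.card_le_card_of_injOn (fun x => -x) (fun x hx => ?_) neg_injective.injOn
    simp only [Finset.coe_filter, Multiset.mem_toFinset, Set.mem_ofPred_eq] at hx ⊢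
    obtain ⟨h1, h2⟩ := hx
    refine ⟨?_, by linarith⟩
    rw [Polynomial.mem_roots'] at h1 ⊢
    refine ⟨fun h0 => h1.1 ?_, ?_⟩
    · ext n
      have := congrArg (fun R => R.coeff n) h0
      rw [hQ] at this
      simp only [Polynomial.comp_C_mul_X_coeff, Polynomial.coeff_zero] at this
      exact (mul_eq_zero.mp this).resolve_right (pow_ne_zero _ (by norm_num))
    · have := h1.2
      rw [Polynomial.IsRoot.def] at this ⊢
      simpa [hQ] using this
  have hsub : P.roots.toFinset ⊆ (P.roots.toFinset.filter (0 < ·) ∪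
      P.roots.toFinset.filter (· < 0)) ∪ {0} := by
    intro x hx
    rcases lt_trichotomy x 0 with h | h | h
    · simp only [Finset.mem_union, Finset.mem_filter]
      exact Or.inl (Or.inr ⟨hx, h⟩)
    · simp [h]
    · simp only [Finset.mem_union, Finset.mem_filter]
      exact Or.inl (Or.inl ⟨hx, h⟩)
  have h1 := Finset.card_le_card hsub
  have h2 := Finset.card_union_le (P.roots.toFinset.filter (0 < ·) ∪
      P.roots.toFinset.filter (· < 0)) {0}
  have h3 := Finset.card_union_le (P.roots.toFinset.filter (0 < ·))
    (P.roots.toFinset.filter (· < 0))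
  have h4 := card_pos_roots_le P
  rw [Finset.card_singleton] at h2
  omega

/-- The restriction of a sparse polynomial to the line `p i = a` is sparse. -/
theorem exists_restriction_to_line (G : MvPolynomial (Fin 2) ℝ) (i : Fin 2) (a : ℝ) :
    ∃ g : Polynomial ℝ, g.support.card ≤ G.support.card ∧
      ∀ y, g.eval y = eval (fun k => if k = i then a else y) G := by
  classical
  let v : Fin 2 → Polynomial ℝ := fun k => if k = i then Polynomial.C a else Polynomial.X
  -- In `Fin 2`, `1 - i` is the other index.
  have hi : ∀ k, k ≠ i → k = 1 - i := by
    intro k hk; omega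
  refine ⟨aeval v G, ?_, fun y => ?_⟩
  · have h1 : aeval v G = ∑ d ∈ G.support,
        Polynomial.C (G.coeff d * a ^ d i) * Polynomial.X ^ d (1 - i) := by
      rw [aeval_def, eval₂_eq']
      refine Finset.sum_congr rfl fun d _ => ?_
      fin_cases i <;> simp [v, Fin.prod_univ_two, Polynomial.algebraMap_eq] <;> ring
    refine le_trans (Finset.card_le_card (t := G.support.image fun d => d (1 - i)) ?_)
      Finset.card_image_le
    intro n hn
    rw [Polynomial.mem_support_iff, h1, Polynomial.finsetSum_coeff] at hn
    obtain ⟨d, hd, hdn⟩ := Finset.exists_ne_zero_of_sum_ne_zero hn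
    rw [Polynomial.coeff_C_mul_X_pow] at hdn
    exact Finset.mem_image.mpr ⟨d, hd, (by by_contra h; exact hdn (if_neg (Ne.symm h)))⟩
  · have : (Polynomial.evalRingHom y).comp (aeval (R := ℝ) v).toRingHom =
        eval (fun k => if k = i then a else y) := by
      refine ringHom_ext (fun r => ?_) fun k => ?_
      · simp [Polynomial.algebraMap_eq]
      · by_cases hk : k = i <;> simp [v, hk]
    exact congrArg (fun h => h G) this

end Lines

/-! ### Covers by preconnected sets and connected components. -/

section Covers

/-- The set `S` is a union of at most `N` preconnected subsets. -/
def IsUnionOfPreconnected (S : Set (Fin 2 → ℝ)) (N : ℕ) : Prop :=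
  ∃ T : Finset (Set (Fin 2 → ℝ)), T.card ≤ N ∧ (∀ A ∈ T, IsPreconnected A ∧ A ⊆ S) ∧
    ∀ p ∈ S, ∃ A ∈ T, p ∈ A

namespace IsUnionOfPreconnected

variable {S S' : Set (Fin 2 → ℝ)} {N N' : ℕ}

theorem mono (h : IsUnionOfPreconnected S N) (hN : N ≤ N') : IsUnionOfPreconnected S N' := by
  obtain ⟨T, h1, h2⟩ := h
  exact ⟨T, h1.trans hN, h2⟩

theorem union (h : IsUnionOfPreconnected S N) (h' : IsUnionOfPreconnected S' N') :
    IsUnionOfPreconnected (S ∪ S') (N + N') := by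
  classical
  obtain ⟨T, h1, h2, h3⟩ := h
  obtain ⟨T', h1', h2', h3'⟩ := h'
  refine ⟨T ∪ T', (Finset.card_union_le _ _).trans (add_le_add h1 h1'), ?_, ?_⟩
  · intro A hA
    rcases Finset.mem_union.mp hA with hA | hA
    · exact ⟨(h2 A hA).1, (h2 A hA).2.trans Set.subset_union_left⟩
    · exact ⟨(h2' A hA).1, (h2' A hA).2.trans Set.subset_union_right⟩
  · rintro p (hp | hp)
    · obtain ⟨A, hA, hpA⟩ := h3 p hp
      exact ⟨A, Finset.mem_union_left _ hA, hpA⟩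
    · obtain ⟨A, hA, hpA⟩ := h3' p hp
      exact ⟨A, Finset.mem_union_right _ hA, hpA⟩

theorem of_iUnion {ι : Type*} [Fintype ι] {A : ι → Set (Fin 2 → ℝ)}
    (hA : ∀ i, IsPreconnected (A i)) : IsUnionOfPreconnected (⋃ i, A i) (Fintype.card ι) := by
  classical
  refine ⟨Finset.univ.image A, Finset.card_image_le, ?_, ?_⟩
  · intro B hB
    obtain ⟨i, _, rfl⟩ := Finset.mem_image.mp hB
    exact ⟨hA i, Set.subset_iUnion A i⟩
  · intro p hp
    obtain ⟨i, hi⟩ := Set.mem_iUnion.mp hp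
    exact ⟨A i, Finset.mem_image_of_mem A (Finset.mem_univ i), hi⟩

theorem of_encard_le (h : S.encard ≤ N) : IsUnionOfPreconnected S N := by
  classical
  have hfin : S.Finite := Set.finite_of_encard_le_coe h
  rw [hfin.encard_eq_coe_toFinset_card] at h
  refine ⟨hfin.toFinset.image fun p => {p}, Finset.card_image_le.trans (by exact_mod_cast h),
    ?_, ?_⟩
  · intro B hB
    obtain ⟨p, hp, rfl⟩ := Finset.mem_image.mp hB
    exact ⟨isPreconnected_singleton, by simpa using hp⟩
  · intro p hp
    exact ⟨{p}, Finset.mem_image_of_mem _ (hfin.mem_toFinset.mpr hp), rfl⟩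

/-- Each piece lies in at most one component, and the pieces meet every component. -/
theorem connectedComponents (h : IsUnionOfPreconnected S N) :
    Finite (ConnectedComponents S) ∧ Nat.card (ConnectedComponents S) ≤ N := by
  classical
  obtain ⟨T, hT, hpre, hcov⟩ := h
  let B : Set (Fin 2 → ℝ) → Set (ConnectedComponents S) := fun A =>
    (fun p : S => (p : ConnectedComponents S)) '' (Subtype.val ⁻¹' A)
  have hB : ∀ A ∈ T, (B A).Subsingleton := by
    rintro A hA _ ⟨p, hp, rfl⟩ _ ⟨q, hq, rfl⟩
    have h1 : IsPreconnected (Subtype.val ⁻¹' A : Set S) := by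
      rw [← Topology.IsInducing.subtypeVal.isPreconnected_image, Subtype.image_preimage_coe,
        Set.inter_eq_self_of_subset_right (hpre A hA).2]
      exact (hpre A hA).1
    rw [ConnectedComponents.coe_eq_coe']
    exact h1.subset_connectedComponent hq hp
  have huniv : (Set.univ : Set (ConnectedComponents S)) = ⋃ A ∈ T, B A := by
    symm
    rw [Set.eq_univ_iff_forall]
    intro c
    obtain ⟨p, rfl⟩ := ConnectedComponents.surjective_coe c
    obtain ⟨A, hA, hpA⟩ := hcov p p.2
    exact Set.mem_biUnion hA ⟨p, hpA, rfl⟩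
  have hcard : (Set.univ : Set (ConnectedComponents S)).encard ≤ N := by
    rw [huniv]
    refine (Finset.set_encard_biUnion_le T B).trans ((Finset.sum_le_sum fun A hA =>
      (Set.encard_le_one_iff_subsingleton.mpr (hB A hA))).trans ?_)
    simpa using hT
  have hfin : (Set.univ : Set (ConnectedComponents S)).Finite := Set.finite_of_encard_le_coe hcard
  refine ⟨Set.finite_univ_iff.mp hfin, ?_⟩
  rw [← Set.ncard_univ]
  rw [← hfin.cast_ncard_eq] at hcard
  exact_mod_cast hcard

/-- In a finite set of points the components are singletons. -/
theorem ncard_le (h : IsUnionOfPreconnected S N) (hS : S.Finite) : S.ncard ≤ N := by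
  have hN := h.connectedComponents.2
  have : Finite S := hS
  have hinj : Function.Injective (fun p : S => (p : ConnectedComponents S)) := by
    intro p q hpq
    have h1 : p ∈ connectedComponent q := ConnectedComponents.coe_eq_coe'.mp hpq
    rwa [connectedComponent_eq_singleton] at h1
  have : Finite (ConnectedComponents S) := h.connectedComponents.1
  have := Nat.card_le_card_of_injective _ hinj
  rw [Nat.card_coe_set_eq] at this
  omega

end IsUnionOfPreconnected

end Covers

/-! ### The bound for an irreducible curve. -/

section Irreducible

variable {F : MvPolynomial (Fin 2) ℝ}

theorem totalDegree_pos_of_irreducible (hF : Irreducible F) : 1 ≤ F.totalDegree := by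
  by_contra h
  rw [totalDegree_eq_zero_iff_eq_C.mp (by omega : F.totalDegree = 0)] at hF
  have hne : F.coeff 0 ≠ 0 := fun h0 => hF.ne_zero (by rw [h0, C_0])
  exact hF.not_isUnit ((isUnit_iff_ne_zero.mpr hne).map C)

/-- The case of a line parallel to a coordinate axis. -/
theorem isUnionOfPreconnected_of_dvd_line (hF : Irreducible F) {i : Fin 2} {a : ℝ}
    (h : F ∣ X i - C a) (G : MvPolynomial (Fin 2) ℝ) :
    IsUnionOfPreconnected (realSolutions F G) (2 * G.support.card + 1) := by
  classical
  obtain ⟨H, hH⟩ := h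
  have hne : (X i - C a : MvPolynomial (Fin 2) ℝ) ≠ 0 := fun h0 => by
    have := congrArg (eval fun _ => a + 1) h0
    simp at this
  have hH0 : H ≠ 0 := fun h0 => hne (by rw [hH, h0, mul_zero])
  have hdeg : F.totalDegree + H.totalDegree ≤ 1 := by
    rw [← totalDegree_mul_of_isDomain hF.ne_zero hH0, ← hH]
    exact (totalDegree_sub_C_le _ _).trans (totalDegree_X (R := ℝ) i).le
  have hd := totalDegree_pos_of_irreducible hF
  have hHC := totalDegree_eq_zero_iff_eq_C.mp (by omega : H.totalDegree = 0)
  have hc : H.coeff 0 ≠ 0 := fun h0 => hH0 (by rw [hHC, h0, C_0])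
  have hzero : ∀ p, eval p F = 0 ↔ p i = a := by
    intro p
    have := congrArg (eval p) hH
    rw [hHC] at this
    simp only [map_sub, map_mul, eval_X, eval_C] at this
    rw [← sub_eq_zero (a := p i), this, mul_eq_zero, or_iff_left hc]
  obtain ⟨g, hg, hgG⟩ := exists_restriction_to_line G i a
  let γ : ℝ → (Fin 2 → ℝ) := fun y k => if k = i then a else y
  have hγ : Continuous γ := continuous_pi fun k => by
    by_cases hk : k = i
    · simpa [γ, hk] using continuous_const
    · simpa [γ, hk] using continuous_id'
  have hS : realSolutions F G = γ '' {y | g.eval y = 0} := by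
    ext p
    constructor
    · rintro ⟨h1, h2⟩
      have hp : γ (p (1 - i)) = p := by
        ext k
        by_cases hk : k = i
        · simp [γ, hk, (hzero p).mp h1]
        · rw [show k = 1 - i by omega]
          simp [γ, show 1 - i ≠ i by omega]
      refine ⟨p (1 - i), ?_, hp⟩
      rw [Set.mem_ofPred_eq, hgG]
      change eval (γ _) G = 0
      rw [hp, h2]
    · rintro ⟨y, hy, rfl⟩
      exact ⟨(hzero _).mpr (by simp [γ]), (hgG y).symm.trans hy⟩
  -- If $G$ vanishes on the line, $S$ is the line, a single piece.
  by_cases hg0 : g = 0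
  · have : IsPreconnected (realSolutions F G) := by
      rw [hS]
      refine IsPreconnected.image ?_ _ hγ.continuousOn
      simpa [hg0] using isPreconnected_univ
    refine ⟨{realSolutions F G}, by simp, by simpa using this, by simp⟩
  · refine IsUnionOfPreconnected.of_encard_le ?_
    rw [hS]
    refine (Set.encard_image_le _ _).trans ?_
    have : {y | g.eval y = 0} = ↑g.roots.toFinset := by
      ext y
      simp [hg0]
    rw [this, Set.encard_coe_eq_coe_finsetCard]
    have := card_roots_toFinset_le g
    exact_mod_cast this.trans (by omega)

/-- A curve all of whose points are critical is a vertical line or has no real points. -/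
theorem eval_ne_zero_of_dvd_pderiv (hF : Irreducible F) (hX : ∀ a, ¬ F ∣ X 0 - C a)
    (hFy : F ∣ pderiv 1 F) (p : Fin 2 → ℝ) : eval p F ≠ 0 := by
  intro hp
  -- A nonzero $F_Y$ has smaller degree than $F$. Once $F_Y=0$, a real zero brings its whole
  -- vertical line.
  have h0 : pderiv 1 F = 0 := by
    by_contra h
    have h1 := totalDegree_pderiv_add_one_le 1 F h
    have h2 := totalDegree_le_of_dvd_of_isDomain hFy h
    omega
  refine hX (p 0) (dvd_of_infinite_zeros hF ?_)
  have hinj : Function.Injective fun y : ℝ => ![p 0, y] := fun y z h => congrFun h 1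
  refine (Set.infinite_range_of_injective hinj).mono ?_
  rintro _ ⟨y, rfl⟩
  refine ⟨?_, by simp⟩
  have hder : ∀ z, HasDerivAt (fun z => eval ![p 0, z] F) 0 z := fun z => by
    simpa [h0] using hasDerivAt_eval_fiber F (p 0) z
  have := is_const_of_deriv_eq_zero (fun z => (hder z).differentiableAt)
    (fun z => (hder z).deriv) y (p 1)
  rw [this, vec_eta, hp]

/-- Here $S$ is the whole curve: graphs over intervals are connected, and exceptional points are
single pieces. -/
theorem CurveBranches.isUnionOfPreconnected_of_dvd {b e : ℕ} (B : CurveBranches F b e)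
    {G : MvPolynomial (Fin 2) ℝ} (h : F ∣ G) :
    IsUnionOfPreconnected (realSolutions F G) (b + e) := by
  have h1 : realSolutions F G =
      (⋃ i, (fun x => ![x, B.branch i x]) '' B.interval i) ∪ B.exceptional := by
    ext p
    obtain ⟨H, rfl⟩ := h
    constructor
    · rintro ⟨hp, -⟩
      refine (B.cover p hp).symm.imp (fun ⟨i, hi, hi'⟩ => Set.mem_iUnion.mpr ⟨i, p 0, hi, ?_⟩) id
      dsimp only
      rw [hi', vec_eta]
    · intro hp
      have : eval p F = 0 := by
        rcases hp with hp | hp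
        · obtain ⟨i, x, hx, rfl⟩ := Set.mem_iUnion.mp hp
          exact B.eval_eq_zero i x hx
        · exact B.exceptional_subset p hp
      exact ⟨this, by rw [map_mul, this, zero_mul]⟩
  rw [h1]
  refine ((IsUnionOfPreconnected.of_iUnion fun i => ?_).mono B.card_le).union
    (IsUnionOfPreconnected.of_encard_le B.encard_exceptional_le)
  refine (B.ordConnected i).isPreconnected.image _ fun x hx => ?_
  refine ContinuousAt.continuousWithinAt (continuousAt_pi.mpr fun k => ?_)
  fin_cases k
  · exact continuousAt_id
  · exact (B.hasDerivAt i x hx).continuousAt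

theorem CurveBranches.encard_realSolutions_sparse_le {b e : ℕ} (B : CurveBranches F b e)
    (hF : Irreducible F) {G : MvPolynomial (Fin 2) ℝ} {t : ℕ} (ht : IsSparse t G) (h : ¬ F ∣ G) :
    (realSolutions F G).encard ≤
      (e + t * (3 * (F.totalDegree * (t * t * F.totalDegree)) + b) : ℕ) := by
  obtain ⟨s, m, c, hs, hc, hind, hdvd⟩ := exists_independent_monomials F G
  have hst : s ≤ t := hs.trans ht
  set g := ∑ j ∈ Finset.range s, c j • monomial (m j) (1 : ℝ) with hg
  have hS : realSolutions F G = realSolutions F g := by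
    obtain ⟨q, hq⟩ := hdvd
    ext p
    refine and_congr_right fun hp => ?_
    have := congrArg (eval p) hq
    rw [map_sub, map_mul, hp, zero_mul, sub_eq_zero] at this
    rw [this]
  rw [hS]
  refine (B.encard_realSolutions_le g).trans ?_
  push_cast
  refine add_le_add le_rfl ?_
  -- Nonvanishing of the Wronskians needs an actual arc of the curve; without one there is nothing
  -- to count.
  by_cases hne : ∃ i, (B.interval i).Nonempty
  swap
  · push Not at hne
    have : B.count g = 0 := Finset.sum_eq_zero fun i _ => by
      simp [CurveBranches.zeros, hne i]
    rw [this]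
    exact zero_le
  obtain ⟨i, hi⟩ := hne
  rcases s with _ | s
  -- No monomials at all would mean $F\mid G$.
  · exact absurd (by simpa [hg] using hdvd) h
  have hW := B.not_dvd_derivationWronskian hF i hi (fun j => monomial (m j) (1 : ℝ)) (s + 1) hind
  have h1 := B.count_linearCombination_le (fun j => monomial (m j) (1 : ℝ)) c s
    (F.totalDegree * (t * t * F.totalDegree)) (hc s (by omega))
    (fun k hk h0 => hW k (by omega) (h0 ▸ dvd_zero F)) fun k hk =>
      (B.count_wronskian_monomial_le hF m k (hW k hk)).trans (by
        have : k ≤ t := hk.trans hst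
        gcongr)
  refine h1.trans ?_
  have h2 : s * (3 * (F.totalDegree * (t * t * F.totalDegree)) + b) +
      F.totalDegree * (t * t * F.totalDegree) ≤
      (s + 1) * (3 * (F.totalDegree * (t * t * F.totalDegree)) + b) := by
    rw [add_mul, one_mul]
    omega
  exact_mod_cast h2.trans (Nat.mul_le_mul_right _ hst)

theorem isUnionOfPreconnected_of_irreducible (hF : Irreducible F) {G : MvPolynomial (Fin 2) ℝ}
    {t : ℕ} (ht1 : 1 ≤ t) (ht : IsSparse t G) :
    IsUnionOfPreconnected (realSolutions F G)
      (12 * (F.totalDegree ^ 3 * t + F.totalDegree ^ 2 * t ^ 3)) := by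
  have hd := totalDegree_pos_of_irreducible hF
  have hline : ∀ (i : Fin 2) (a : ℝ), F ∣ X i - C a → IsUnionOfPreconnected (realSolutions F G)
      (12 * (F.totalDegree ^ 3 * t + F.totalDegree ^ 2 * t ^ 3)) := by
    intro i a h
    refine (isUnionOfPreconnected_of_dvd_line hF h G).mono ?_
    have h1 : 1 * t ≤ F.totalDegree ^ 3 * t := Nat.mul_le_mul_right _ (Nat.one_le_pow _ _ hd)
    have h2 : G.support.card ≤ t := ht
    omega
  by_cases hX : ∃ a, F ∣ X 0 - C a
  · obtain ⟨a, ha⟩ := hX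
    exact hline 0 a ha
  push Not at hX
  by_cases hY : F ∣ X 1
  · exact hline 1 0 (by simpa using hY)
  by_cases hFy : F ∣ pderiv 1 F
  · refine IsUnionOfPreconnected.of_encard_le ?_
    have : realSolutions F G = ∅ := Set.eq_empty_of_forall_notMem fun p hp =>
      eval_ne_zero_of_dvd_pderiv hF hX hFy p hp.1
    simp [this]
  obtain ⟨B⟩ := nonempty_curveBranches hF hX hY hFy rfl
  set d := F.totalDegree
  have hN : d * d + 2 * d + 1 ≤ 4 * d ^ 2 := by nlinarith
  have he : (d * d + 2 * d + 1) * d ≤ 4 * d ^ 3 :=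
    (Nat.mul_le_mul_right d hN).trans_eq (by ring)
  have hb : (d * d + 2 * d + 1 + 1) * d ≤ 5 * d ^ 3 := by
    have : 1 * d ≤ d ^ 2 * d := Nat.mul_le_mul_right d (Nat.one_le_pow _ _ hd)
    calc (d * d + 2 * d + 1 + 1) * d = (d * d + 2 * d + 1) * d + 1 * d := by ring
      _ ≤ 4 * d ^ 3 + d ^ 2 * d := add_le_add he this
      _ = 5 * d ^ 3 := by ring
  have htd : d ^ 3 ≤ d ^ 3 * t := Nat.le_mul_of_pos_right _ ht1
  -- With $e\le4d^3$ and $b\le5d^3$, the two cases give $9d^3$ and $4d^3+5d^3t+3d^2t^3$, both within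
  -- the constant 12.
  by_cases hFG : F ∣ G
  · refine (B.isUnionOfPreconnected_of_dvd hFG).mono ?_
    have : d ^ 3 ≤ d ^ 3 * t := htd
    omega
  · refine IsUnionOfPreconnected.of_encard_le
      ((B.encard_realSolutions_sparse_le hF ht hFG).trans ?_)
    norm_cast
    calc _ ≤ 4 * d ^ 3 + t * (3 * (d * (t * t * d)) + 5 * d ^ 3) := by gcongr
      _ = 4 * d ^ 3 + (5 * (d ^ 3 * t) + 3 * (d ^ 2 * t ^ 3)) := by ring
      _ ≤ 12 * (d ^ 3 * t + d ^ 2 * t ^ 3) := by omega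

end Irreducible

/-- Induction over irreducible factors: $G$ and $t$ stay fixed, degrees add, and cubes and squares
of degrees are superadditive, so the constant does not grow. -/
theorem isUnionOfPreconnected_realSolutions {F G : MvPolynomial (Fin 2) ℝ} (hF : F ≠ 0)
    {t : ℕ} (ht1 : 1 ≤ t) (ht : IsSparse t G) :
    IsUnionOfPreconnected (realSolutions F G)
      (12 * (F.totalDegree ^ 3 * t + F.totalDegree ^ 2 * t ^ 3)) := by
  induction F using WfDvdMonoid.induction_on_irreducible with
  | zero => exact absurd rfl hF
  | unit u hu =>
    refine IsUnionOfPreconnected.of_encard_le ?_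
    have : realSolutions u G = ∅ := Set.eq_empty_of_forall_notMem fun p hp =>
      (hu.map (eval p)).ne_zero hp.1
    simp [this]
  | mul a i ha hi ih =>
    have hS : realSolutions (i * a) G = realSolutions i G ∪ realSolutions a G := by
      ext p
      simp [realSolutions, or_and_right]
    rw [hS, totalDegree_mul_of_isDomain hi.ne_zero ha]
    refine ((isUnionOfPreconnected_of_irreducible hi ht1 ht).union (ih ha)).mono ?_
    set d := i.totalDegree
    set e := a.totalDegree
    have h3 : d ^ 3 + e ^ 3 ≤ (d + e) ^ 3 :=
      pow_add_pow_le (Nat.zero_le _) (Nat.zero_le _) (by norm_num)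
    have h2 : d ^ 2 + e ^ 2 ≤ (d + e) ^ 2 :=
      pow_add_pow_le (Nat.zero_le _) (Nat.zero_le _) (by norm_num)
    have h3' := Nat.mul_le_mul_right t h3
    have h2' := Nat.mul_le_mul_right (t ^ 3) h2
    rw [add_mul] at h2' h3'
    omega

theorem mainTheorem1 :
    ∃ C : ℕ, ∀ (d t : ℕ) (F G : MvPolynomial (Fin 2) ℝ),
      F ≠ 0 → F.totalDegree = d → 1 ≤ t → IsSparse t G →
        (Finite (ConnectedComponents (realSolutions F G)) ∧
          Nat.card (ConnectedComponents (realSolutions F G)) ≤ C * (d ^ 3 * t + d ^ 2 * t ^ 3)) ∧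
        ((realSolutions F G).Finite →
          (realSolutions F G).ncard ≤ C * (d ^ 3 * t + d ^ 2 * t ^ 3)) := by
  refine ⟨12, ?_⟩
  rintro _ t F G hF rfl ht1 ht
  have h := isUnionOfPreconnected_realSolutions hF ht1 ht
  exact ⟨h.connectedComponents, h.ncard_le⟩
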